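/- A finite deterministic dynamical system (FDDS) is a finite set $A$ with a map $f_A:A\to A$, considered up to isomorphism; sum is disjoint union and product is the direct product $(f_A\times f_B$ on $A\times B)$. A permutation is an FDDS whose map is bijective, that is, a sum of cycles; $C_a$ denotes the cycle of length $a$, $|A|$ the number of states of $A$, and $\ell(A)$ the length of the shortest cycle of a nonempty permutation $A$. A polynomial $P=\sum_i A_iX^{p_i}$ over the permutations (distinct exponents $p_i\ge 0$, nonzero permutations $A_i$) is pseudo-injective of seed $g$ if it is not constant, $g$ is the smallest cycle length occurring in the coefficients of its non-constant monomials, and $g$ divides every cycle length occurring in these coefficients. If $a\mid b$ are positive integers, $\operatorname{alcm}_a b$ is the smallest $c$ with $\operatorname{lcm}(a,c)=b$. Consider the following algorithm, for a pseudo-injective polynomial $P$ of seed $g$ over the permutations and a permutation $B$. Let $X=0$. While $B-P(X)\neq 0$, set $X=X+C_{\operatorname{alcm}_g \ell(B-P(X))}$. If at any moment $|P(X)|>|B|$, or $P(X)$ is not a submultiset of $B$ (i.e. there is no $D$ with $P(X)+D=B$), or $g\nmid \ell(B-P(X))$, then the result is "undefined". Otherwise the final value of $X$ is returned. **Proposition.**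 For every pseudo-injective polynomial $P$ over the permutations and every permutation $B$, this algorithm terminates; if it returns $X$, then $P(X)=B$, and if its result is "undefined", then no permutation $X$ satisfies $P(X)=B$. Moreover, its result can be computed in time polynomial in $\sum_i|A_i|+|B|$, the sum of the sizes of the coefficients of $P$ and the size of $B$; hence equations $P(X)=B$ of this form are solved in polynomial time. Here a permutation is given and returned as an explicit graph (its number of states and the successor of each state), $P$ is given as the list of the pairs $(p_i,A_i)$, and time is the number of steps of a random access machine with unit-cost addition, truncated subtraction, zero tests and array access on natural numbers. -/

import Mathlib

/-! ### Finite deterministic dynamical systems -/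

/-- A finite deterministic dynamical system: a finite set of states with a total transition
function.  Systems are compared up to isomorphism, by `FDDS.Iso` below. -/
structure FDDS where
  State : Type
  finite : Finite State
  next : State → State

namespace FDDS

/-- Isomorphism of systems: a bijection of the states that commutes with the transitions.
This is the equality of the semiring of systems up to isomorphism. -/
def Iso (A B : FDDS) : Prop :=
  ∃ e : A.State ≃ B.State, ∀ s, e (A.next s) = B.next (e s)

/-- The system with no state. -/
def zero : FDDS := ⟨Empty, inferInstance, id⟩

/-- The system consisting of a single fixed point. -/
def one : FDDS := ⟨Unit, inferInstance, id⟩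

/-- Sum (alternative execution): the disjoint union of the transition graphs. -/
def add (A B : FDDS) : FDDS :=
  ⟨A.State ⊕ B.State,
    (by have := A.finite; have := B.finite; infer_instance),
    Sum.map A.next B.next⟩

/-- Product (synchronous execution): the direct product of the transition graphs. -/
def mul (A B : FDDS) : FDDS :=
  ⟨A.State × B.State,
    (by have := A.finite; have := B.finite; infer_instance),
    Prod.map A.next B.next⟩

/-- Powers with respect to the product; the empty product is the fixed point. -/
def pow (A : FDDS) : ℕ → FDDS
  | 0 => one
  | k + 1 => mul (pow A k) A

/-- The cycle `C_a` of length `a`. -/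
def cycle (a : ℕ) : FDDS := ⟨Fin a, inferInstance, finRotate a⟩

/-- The number of states. -/
noncomputable def size (A : FDDS) : ℕ := Nat.card A.State

/-- A permutation is a system without transient states. -/
def IsPermutation (A : FDDS) : Prop := Function.Bijective A.next

/-- `A` is a submultiset of `B` if `A + D = B` for some system `D`. -/
def Sub (A B : FDDS) : Prop := ∃ D : FDDS, Iso (add A D) B

/-- The set of the lengths of the cycles of `A`. -/
def cycleLengths (A : FDDS) : Set ℕ :=
  {l | ∃ s ∈ Function.periodicPts A.next, Function.minimalPeriod A.next s = l}

/-- The length of the shortest cycle of `A` (used only for nonempty `A`). -/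
noncomputable def minLength (A : FDDS) : ℕ := sInf A.cycleLengths

end FDDS

/-! ### Permutations given by explicit graphs, and polynomials over them -/

/-- A permutation given explicitly, on the states `0, …, n - 1`.  Every permutation system is
isomorphic to one of these. -/
structure PermGraph where
  n : ℕ
  next : Equiv.Perm (Fin n)

/-- The dynamical system of an explicitly given permutation. -/
def PermGraph.toFDDS (A : PermGraph) : FDDS := ⟨Fin A.n, inferInstance, A.next⟩

/-- A polynomial `∑ A_i X ^ p_i` over the permutations: the finite list of the pairs
`(p_i, A_i)` with distinct exponents and nonzero coefficients. -/
structure PermPoly where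
  terms : List (ℕ × PermGraph)
  nodup : (terms.map Prod.fst).Nodup
  ne_zero : ∀ m ∈ terms, m.2.n ≠ 0

namespace PermPoly

/-- The value `P(X)`. -/
def eval (P : PermPoly) (X : FDDS) : FDDS :=
  P.terms.foldr (fun m S => FDDS.add (FDDS.mul m.2.toFDDS (FDDS.pow X m.1)) S) FDDS.zero

/-- The sum of the sizes (numbers of states) of the coefficients.  Exponents do not count. -/
def size (P : PermPoly) : ℕ := (P.terms.map fun m => m.2.n).sum

/-- The lengths of all the cycles of the coefficients of the non-constant monomials. -/
def nonconstLengths (P : PermPoly) : Set ℕ :=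
  {l | ∃ m ∈ P.terms, m.1 ≠ 0 ∧ l ∈ m.2.toFDDS.cycleLengths}

/-- The seed: the least cycle length in the coefficients of the non-constant monomials. -/
noncomputable def seed (P : PermPoly) : ℕ := sInf P.nonconstLengths

/-- `P` is pseudo-injective: it is not constant, and its seed divides all the cycle lengths of
the coefficients of its non-constant monomials. -/
def PseudoInjective (P : PermPoly) : Prop :=
  P.nonconstLengths.Nonempty ∧ ∀ l ∈ P.nonconstLengths, P.seed ∣ l

end PermPoly

/-- The anti-lcm of `b` with respect to `a`: the least `c` with `lcm(a, c) = b`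
(used only for `0 < a`, `0 < b` and `a ∣ b`, when such a `c` exists). -/
noncomputable def alcm (a b : ℕ) : ℕ := sInf {c | Nat.lcm a c = b}

/-! ### The algorithm that repeatedly adds the cycle of anti-lcm length -/

/-- `PolyCycleFrom P B X r`: the loop of the algorithm, entered with the current value `X`, ends
with the result `r`, which is a permutation (up to isomorphism) or `none` for "undefined".
Throughout, `D` is the current difference `B - P(X)`. -/
inductive PolyCycleFrom (P : PermPoly) (B : PermGraph) : FDDS → Option PermGraph → Prop
  | done (X : FDDS) (Y : PermGraph) :
      FDDS.Iso (P.eval X) B.toFDDS → FDDS.Iso X Y.toFDDS → PolyCycleFrom P B X (some Y)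
  | step (X D : FDDS) (r : Option PermGraph) :
      FDDS.Iso (FDDS.add (P.eval X) D) B.toFDDS → D.size ≠ 0 → P.seed ∣ D.minLength →
      PolyCycleFrom P B (FDDS.add X (FDDS.cycle (alcm P.seed D.minLength))) r →
      PolyCycleFrom P B X r
  | exceeded (X : FDDS) :
      (B.n < (P.eval X).size ∨ ¬ FDDS.Sub (P.eval X) B.toFDDS) → PolyCycleFrom P B X none
  | noAlcm (X D : FDDS) :
      FDDS.Iso (FDDS.add (P.eval X) D) B.toFDDS → D.size ≠ 0 → ¬ P.seed ∣ D.minLength →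
      PolyCycleFrom P B X none

/-- `r` is the result of the algorithm on `P` and `B`; the loop starts with `X = 0`. -/
def PolyCycle (P : PermPoly) (B : PermGraph) (r : Option PermGraph) : Prop :=
  PolyCycleFrom P B FDDS.zero r

/-! ### Random access machines with a step count

Structured programs for a random access machine with registers `x_0, x_1, …` and arrays
`a_0, a_1, …` of natural numbers, at unit cost.  The only arithmetic is addition and truncated
subtraction, so that in `t` steps the contents grow by at most `O(t)` bits; hence polynomial time
here is polynomial time on a Turing machine whenever the numbers in the input are counted with
their bits. -/

/-- The contents of the registers and of the arrays. -/
structure Store where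
  reg : ℕ → ℕ
  arr : ℕ → ℕ → ℕ

/-- Assign `v` to the register `i`. -/
def Store.setReg (s : Store) (i v : ℕ) : Store :=
  ⟨Function.update s.reg i v, s.arr⟩

/-- Assign `v` to the cell `j` of the array `a`. -/
def Store.setCell (s : Store) (a j v : ℕ) : Store :=
  ⟨s.reg, Function.update s.arr a (Function.update (s.arr a) j v)⟩

/-- Programs; all the arguments are fixed numbers, written in the program. -/
inductive Prog where
  /-- `x_i := c` -/
  | const (i c : ℕ)
  /-- `x_i := x_j + x_k` -/
  | add (i j k : ℕ)
  /-- `x_i := x_j - x_k`, truncated at `0` -/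
  | sub (i j k : ℕ)
  /-- `x_i := a[x_j]` -/
  | load (i a j : ℕ)
  /-- `a[x_j] := x_i` -/
  | store (a j i : ℕ)
  /-- `p; q` -/
  | seq (p q : Prog)
  /-- `if x_i ≠ 0 then p else q` -/
  | ite (i : ℕ) (p q : Prog)
  /-- `while x_i ≠ 0 do p` -/
  | loop (i : ℕ) (p : Prog)

/-- `Exec p s t s'`: started on `s`, the program `p` halts after exactly `t` steps with `s'`.
Every assignment and every test is one step. -/
inductive Exec : Prog → Store → ℕ → Store → Prop
  | const (i c : ℕ) (s : Store) : Exec (.const i c) s 1 (s.setReg i c)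
  | add (i j k : ℕ) (s : Store) : Exec (.add i j k) s 1 (s.setReg i (s.reg j + s.reg k))
  | sub (i j k : ℕ) (s : Store) : Exec (.sub i j k) s 1 (s.setReg i (s.reg j - s.reg k))
  | load (i a j : ℕ) (s : Store) : Exec (.load i a j) s 1 (s.setReg i (s.arr a (s.reg j)))
  | store (a j i : ℕ) (s : Store) : Exec (.store a j i) s 1 (s.setCell a (s.reg j) (s.reg i))
  | seq {p q : Prog} {s s' s'' : Store} {t t' : ℕ} :
      Exec p s t s' → Exec q s' t' s'' → Exec (.seq p q) s (t + t') s''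
  | ite_true {i : ℕ} {p q : Prog} {s s' : Store} {t : ℕ} :
      s.reg i ≠ 0 → Exec p s t s' → Exec (.ite i p q) s (t + 1) s'
  | ite_false {i : ℕ} {p q : Prog} {s s' : Store} {t : ℕ} :
      s.reg i = 0 → Exec q s t s' → Exec (.ite i p q) s (t + 1) s'
  | loop_exit {i : ℕ} {p : Prog} {s : Store} :
      s.reg i = 0 → Exec (.loop i p) s 1 s
  | loop_step {i : ℕ} {p : Prog} {s s' s'' : Store} {t t' : ℕ} :
      s.reg i ≠ 0 → Exec p s t s' → Exec (.loop i p) s' t' s'' →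
      Exec (.loop i p) s (t + t' + 1) s''

/-- The explicit graph as a word: the number of states, then the successor of each state. -/
def PermGraph.encode (A : PermGraph) : List ℕ :=
  A.n :: List.ofFn fun i => (A.next i : ℕ)

/-- The input word of an equation `P(X) = B`: the number of monomials, then the exponent and the
graph of the coefficient of each monomial, then the graph of `B`. -/
def encodeEquation (P : PermPoly) (B : PermGraph) : List ℕ :=
  P.terms.length :: (P.terms.flatMap fun m => m.1 :: m.2.encode) ++ B.encode

/-- The output word: `0` for "undefined", or `1` followed by the graph of the solution. -/
def encodeResult : Option PermGraph → List ℕ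
  | none => [0]
  | some X => 1 :: X.encode

/-- Initially the array `a_0` holds the input word and everything else is `0`. -/
def Store.ofInput (w : List ℕ) : Store :=
  ⟨fun _ => 0, fun a j => if a = 0 then w.getD j 0 else 0⟩

/-- At the end the array `a_1` starts with the output word (output words are self-delimiting). -/
def Store.HasOutput (s : Store) (w : List ℕ) : Prop :=
  ∀ j < w.length, s.arr 1 j = w.getD j 0

/-! ### Counting the fixed points of the iterates -/

/-! A permutation is determined up to isomorphism by the numbers of fixed points of its iterates
(`iso_of_fixCount_eq`), and for each `n` this number is additive and multiplicative. So `P(X) = B`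
amounts to one numerical equation `P_n(x_n) = b_n` for each `n`. The cycle `C_a` has fixed points
under its `n`-th iterate if and only if `a ∣ n`; hence, for a pseudo-injective `P` of seed `g`, the
function `P_n` is strictly increasing if `g ∣ n` and constant otherwise. Only the counts of `X` at
multiples of `g` matter.

On multiples `n` of `g`, the conditions `c ∣ n` and `a ∣ n` agree for `a = alcm g (lcm g c)`, and `a
∣ c`; so `C_c` may be replaced by `c / a` copies of `C_a` (`exists_completes`). Let `X` be a part of
such a normalized solution and `R` the list of the missing lengths. Then `B - P(X)` has fixed points
at `n` exactly when `g ∣ n` and some `a ∈ R` divides `n`. Its shortest cycle therefore has length `l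
= lcm g a` for some `a ∈ R`, and normality gives `alcm g l = a` (`Completes.exists_least`): each
step of the algorithm adds a missing cycle. If there is no solution, `|X| ≤ |P(X)| ≤ |B|` bounds the
growth of `X`, and the loop can only end as "undefined" (`polyCycleFrom_none`).

For the running time, `P(X)` is never built. The program computes counts truncated at a bound `K`
larger than the sizes of the input, which is harmless because they are only compared with counts of
`B`, all below `K`. It does not test the failure conditions either: for `K` rounds it appends the
next cycle whenever it fits, and then checks the equation once. If a solution exists, the rounds
follow the algorithm; otherwise the check fails (`exists_result`). Polynomial time comes from the
closure properties of `Cmp` and `Act`: every loop is capped by register `0`, and time is bounded in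
terms of that register alone. -/

theorem val_finRotate {a : ℕ} (i : Fin a) : (finRotate a i : ℕ) = (i + 1) % a := by
  rcases a with _ | a
  · exact i.elim0
  · simp [finRotate_apply, Fin.val_add]

namespace FDDS

instance (A : FDDS) : Finite A.State := A.finite

/-- The number of fixed points of the `n`-th iterate of `A`. -/
noncomputable def fixCount (A : FDDS) (n : ℕ) : ℕ := Nat.card {s : A.State // A.next^[n] s = s}

theorem fixCount_zero_right (A : FDDS) : A.fixCount 0 = A.size := by
  simp only [fixCount, size, Function.iterate_zero, id]
  exact Nat.card_congr (Equiv.subtypeUnivEquiv fun _ => trivial)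

theorem Iso.symm {A B : FDDS} (h : Iso A B) : Iso B A := by
  obtain ⟨e, he⟩ := h
  refine ⟨e.symm, fun s => ?_⟩
  rw [Equiv.symm_apply_eq, he, Equiv.apply_symm_apply]

theorem Iso.refl (A : FDDS) : Iso A A := ⟨Equiv.refl _, fun _ => rfl⟩

theorem Iso.trans {A B C : FDDS} (h : Iso A B) (h' : Iso B C) : Iso A C := by
  obtain ⟨e, he⟩ := h
  obtain ⟨e', he'⟩ := h'
  exact ⟨e.trans e', fun s => by simp [he, he']⟩

theorem Iso.add_congr {A B C D : FDDS} (h : Iso A B) (h' : Iso C D) :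
    Iso (add A C) (add B D) := by
  obtain ⟨e, he⟩ := h
  obtain ⟨e', he'⟩ := h'
  refine ⟨Equiv.sumCongr e e', ?_⟩
  rintro (s | s)
  · exact congrArg Sum.inl (he s)
  · exact congrArg Sum.inr (he' s)

theorem Iso.fixCount_eq {A B : FDDS} (h : Iso A B) (n : ℕ) : A.fixCount n = B.fixCount n := by
  obtain ⟨e, he⟩ := h
  have hs : Function.Semiconj e A.next B.next := he
  refine Nat.card_congr (e.subtypeEquiv fun s => ?_)
  rw [← (hs.iterate_right n).eq, e.apply_eq_iff_eq]

theorem Iso.isPermutation {A B : FDDS} (h : Iso A B) (hB : B.IsPermutation) :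
    A.IsPermutation := by
  obtain ⟨e, he⟩ := h
  have : A.next = e.symm ∘ B.next ∘ e := by
    funext s; simp [← he]
  rw [IsPermutation, this]
  exact e.symm.bijective.comp (hB.comp e.bijective)

theorem fixCount_zero (n : ℕ) : zero.fixCount n = 0 := by
  have : IsEmpty {s : zero.State // zero.next^[n] s = s} := ⟨fun s => Empty.elim s.1⟩
  exact Nat.card_of_isEmpty

theorem fixCount_one (n : ℕ) : one.fixCount n = 1 := by
  have : Unique {s : one.State // one.next^[n] s = s} :=
    { default := ⟨(), rfl⟩, uniq := fun _ => rfl }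
  exact Nat.card_unique

theorem fixCount_add (A B : FDDS) (n : ℕ) :
    (add A B).fixCount n = A.fixCount n + B.fixCount n := by
  have h (x : A.State ⊕ B.State) :
      (Sum.map A.next B.next)^[n] x = Sum.map (A.next^[n]) (B.next^[n]) x := by
    induction n generalizing x with
    | zero => simp
    | succ n ih => rw [Function.iterate_succ_apply, ih]; rcases x with x | x <;> simp
  change Nat.card {x : A.State ⊕ B.State // (Sum.map A.next B.next)^[n] x = x} = _
  simp only [h, fixCount]
  rw [← Nat.card_sum, Nat.card_congr Equiv.subtypeSum]
  simp only [Sum.map_inl, Sum.map_inr, Sum.inl.injEq, Sum.inr.injEq]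

theorem fixCount_mul (A B : FDDS) (n : ℕ) :
    (mul A B).fixCount n = A.fixCount n * B.fixCount n := by
  change Nat.card {x : A.State × B.State // (Prod.map A.next B.next)^[n] x = x} = _
  simp only [Prod.map_iterate, Prod.ext_iff, Prod.map_fst, Prod.map_snd, fixCount]
  rw [← Nat.card_prod]
  exact Nat.card_congr (Equiv.subtypeProdEquivProd (p := fun a => A.next^[n] a = a)
    (q := fun b => B.next^[n] b = b))

theorem fixCount_pow (A : FDDS) (k n : ℕ) : (pow A k).fixCount n = A.fixCount n ^ k := by
  induction k with
  | zero => exact fixCount_one n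
  | succ k ih => rw [pow, fixCount_mul, ih, pow_succ]

theorem fixCount_cycle (a n : ℕ) : (cycle a).fixCount n = if a ∣ n then a else 0 := by
  rcases a with _ | a
  · have : IsEmpty {s : (cycle 0).State // (cycle 0).next^[n] s = s} := ⟨fun s => Fin.elim0 s.1⟩
    simp [fixCount]
  have h (x : Fin (a + 1)) : (finRotate (a + 1))^[n] x = x + Fin.ofNat (a + 1) n := by
    induction n with
    | zero => ext; simp
    | succ n ih =>
      rw [Function.iterate_succ_apply', ih, finRotate_apply]
      ext; simp [Fin.val_add, add_assoc]
  have h2 (x : Fin (a + 1)) : (finRotate (a + 1))^[n] x = x ↔ a + 1 ∣ n := by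
    rw [h, add_eq_left, Fin.ext_iff]
    simp [Nat.dvd_iff_mod_eq_zero]
  change Nat.card {s : Fin (a + 1) // (finRotate (a + 1))^[n] s = s} = _
  simp only [h2]
  split_ifs with hd <;> simp [hd]

/-! ### Closure of permutations under the operations -/

theorem zero_isPermutation : zero.IsPermutation := Function.bijective_id

theorem one_isPermutation : one.IsPermutation := Function.bijective_id

theorem cycle_isPermutation (a : ℕ) : (cycle a).IsPermutation := (finRotate a).bijective

theorem IsPermutation.add {A B : FDDS} (hA : A.IsPermutation) (hB : B.IsPermutation) :
    (add A B).IsPermutation :=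
  ⟨Function.Injective.sumMap hA.1 hB.1, Function.Surjective.sumMap hA.2 hB.2⟩

theorem IsPermutation.mul {A B : FDDS} (hA : A.IsPermutation) (hB : B.IsPermutation) :
    (mul A B).IsPermutation :=
  Function.Bijective.prodMap hA hB

theorem IsPermutation.pow {A : FDDS} (hA : A.IsPermutation) (k : ℕ) : (pow A k).IsPermutation := by
  induction k with
  | zero => exact one_isPermutation
  | succ k ih => exact ih.mul hA

/-! ### Splitting off a cycle, and isomorphism of permutations -/

theorem fixCount_pos_iff (A : FDDS) (n : ℕ) : 0 < A.fixCount n ↔ ∃ s, A.next^[n] s = s := by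
  rw [fixCount, Nat.card_pos_iff]
  simp only [nonempty_subtype, and_iff_left_iff_imp]
  exact fun _ => inferInstance

/-- By injectivity the orbit of `s` is closed under preimages as well as images, so its complement
is a system of its own, and the orbit is parametrized by the exponents below the minimal period. -/
theorem IsPermutation.exists_add_iso {A : FDDS} (hA : A.IsPermutation) (s : A.State) :
    ∃ A' : FDDS, A'.IsPermutation ∧
      Iso (FDDS.add (cycle (Function.minimalPeriod A.next s)) A') A := by
  set a := Function.minimalPeriod A.next s with ha
  have hs : s ∈ Function.periodicPts A.next := hA.1.mem_periodicPts s
  have hpos : 0 < a := Function.minimalPeriod_pos_of_mem_periodicPts hs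
  have hinv (y : A.State) : (∃ k, A.next^[k] s = A.next y) ↔ ∃ k, A.next^[k] s = y := by
    constructor
    · rintro ⟨k, hk⟩
      -- If `s` itself is the successor of `y`, then `y` is the last point of the cycle, at exponent
      -- `a - 1`.
      rcases k with _ | k
      · refine ⟨a - 1, hA.1 ?_⟩
        rw [← Function.iterate_succ_apply' A.next, ← hk, Nat.succ_eq_add_one, Nat.sub_add_cancel hpos]
        exact Function.iterate_minimalPeriod
      · exact ⟨k, hA.1 (by rw [← Function.iterate_succ_apply' A.next, hk])⟩
    · rintro ⟨k, rfl⟩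
      exact ⟨k + 1, Function.iterate_succ_apply' _ _ _⟩
  let C : FDDS := ⟨{y : A.State // ¬ ∃ k, A.next^[k] s = y}, inferInstance,
    fun y => ⟨A.next y.1, fun h => y.2 ((hinv _).1 h)⟩⟩
  have hCinj : Function.Injective C.next := fun x y h => Subtype.ext (hA.1 (Subtype.ext_iff.1 h))
  refine ⟨C, Finite.injective_iff_bijective.1 hCinj, ?_⟩
  let F : Fin a ⊕ C.State → A.State := Sum.elim (fun i => A.next^[i.1] s) (fun y => y.1)
  have hF : Function.Bijective F := by
    constructor
    · rintro (i | y) (j | z) h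
      · congr 1
        exact Fin.ext (Function.iterate_injOn_Iio_minimalPeriod i.2 j.2 h)
      · exact (z.2 ⟨_, h⟩).elim
      · exact (y.2 ⟨_, h.symm⟩).elim
      · exact congrArg Sum.inr (Subtype.ext h)
    · intro y
      by_cases h : ∃ k, A.next^[k] s = y
      · obtain ⟨k, rfl⟩ := h
        exact ⟨Sum.inl ⟨k % a, Nat.mod_lt _ hpos⟩, Function.iterate_mod_minimalPeriod_eq⟩
      · exact ⟨Sum.inr ⟨y, h⟩, rfl⟩
  refine ⟨Equiv.ofBijective F hF, ?_⟩
  rintro (i | y)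
  · have hrot (i : Fin a) : A.next^[(finRotate a i).1] s = A.next (A.next^[i.1] s) := by
      rw [val_finRotate, Function.iterate_mod_minimalPeriod_eq, Function.iterate_succ_apply']
    exact hrot i
  · rfl

/-- The least positive `n` with a nonzero count is the length of the shortest cycle, hence the same
in `A` and `B`. Remove such a cycle from both and induct on the size. Minimal periods do not exceed
the size, so the counts up to `A.size` suffice; the program relies on this bound. -/
theorem iso_of_fixCount_eq {A B : FDDS} (hA : A.IsPermutation) (hB : B.IsPermutation)
    (h : ∀ n ≤ A.size, A.fixCount n = B.fixCount n) : Iso A B := by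
  induction hk : A.size using Nat.strong_induction_on generalizing A B with
  | _ k ih =>
  have h0 : A.size = B.size := by
    rw [← fixCount_zero_right, ← fixCount_zero_right, h 0 (Nat.zero_le _)]
  rcases isEmpty_or_nonempty A.State with hE | ⟨⟨s0⟩⟩
  · have hE' : IsEmpty B.State := by
      have : A.size = 0 := Nat.card_of_isEmpty
      rw [this] at h0
      rcases Nat.card_eq_zero.1 h0.symm with h | h
      · exact h
      · exact (h.not_finite inferInstance).elim
    exact ⟨Equiv.equivOfIsEmpty _ _, fun s => (hE.false s).elim⟩
  have hex : ∃ n, 0 < n ∧ 0 < A.fixCount n :=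
    ⟨_, Function.minimalPeriod_pos_of_mem_periodicPts (hA.1.mem_periodicPts s0),
      (fixCount_pos_iff _ _).2 ⟨s0, Function.iterate_minimalPeriod⟩⟩
  classical
  set l := Nat.find hex with hl
  obtain ⟨hl0, hlA⟩ := Nat.find_spec hex
  have hmin (C : FDDS) (hC : C.IsPermutation) (hle : ∀ n < l, 0 < n → C.fixCount n = 0)
      (s : C.State) (hs : C.next^[l] s = s) : Function.minimalPeriod C.next s = l := by
    have hp := Function.minimalPeriod_pos_of_mem_periodicPts (hC.1.mem_periodicPts s)
    refine le_antisymm (Nat.le_of_dvd hl0 (Function.IsPeriodicPt.minimalPeriod_dvd hs)) ?_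
    by_contra hlt
    have := (fixCount_pos_iff C (Function.minimalPeriod C.next s)).2
      ⟨s, Function.iterate_minimalPeriod⟩
    have := hle _ (not_le.1 hlt) hp
    omega
  have hA0 (n) (hn : n < l) (hn0 : 0 < n) : A.fixCount n = 0 := by
    have := Nat.find_min hex hn
    simp only [not_and, not_lt] at this
    exact Nat.le_zero.1 (this hn0)
  obtain ⟨s, hs⟩ := (fixCount_pos_iff _ _).1 hlA
  have hsl := hmin A hA hA0 s hs
  have hlsize : l ≤ A.size := by
    have := Fintype.ofFinite A.State
    rw [← hsl, size, Nat.card_eq_fintype_card]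
    exact Function.minimalPeriod_le_card
  obtain ⟨t, ht⟩ := (fixCount_pos_iff B l).1 (by rw [← h l hlsize]; exact hlA)
  have htl := hmin B hB (fun n hn hn0 => by rw [← h n (by omega), hA0 n hn hn0]) t ht
  obtain ⟨A', hA', hAA'⟩ := hA.exists_add_iso s
  obtain ⟨B', hB', hBB'⟩ := hB.exists_add_iso t
  rw [hsl] at hAA'
  rw [htl] at hBB'
  have hsz : A'.size + l = A.size := by
    have := hAA'.fixCount_eq 0
    rw [fixCount_add, fixCount_cycle, if_pos (dvd_zero l), fixCount_zero_right,
      fixCount_zero_right] at this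
    omega
  have hiso : Iso A' B' := by
    refine ih A'.size (by omega) hA' hB' (fun n hn => ?_) rfl
    have h1 := hAA'.fixCount_eq n
    have h2 := hBB'.fixCount_eq n
    rw [fixCount_add] at h1 h2
    have := h n (by omega)
    omega
  exact hAA'.symm.trans (((Iso.refl _).add_congr hiso).trans hBB')

/-- The number of fixed points of the `n`-th iterate of a sum of cycles. -/
def listCount (L : List ℕ) (n : ℕ) : ℕ := (L.map fun a => if a ∣ n then a else 0).sum

theorem listCount_cons (a : ℕ) (L : List ℕ) (n : ℕ) :
    listCount (a :: L) n = (if a ∣ n then a else 0) + listCount L n := by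
  simp [listCount]

theorem listCount_perm {L L' : List ℕ} (h : L.Perm L') (n : ℕ) : listCount L n = listCount L' n :=
  (h.map _).sum_eq

theorem listCount_pos_iff (L : List ℕ) (n : ℕ) : 0 < listCount L n ↔ ∃ a ∈ L, 0 < a ∧ a ∣ n := by
  induction L with
  | nil => simp [listCount]
  | cons a L ih =>
    rw [listCount_cons, Nat.add_pos_iff_pos_or_pos, ih]
    by_cases h : a ∣ n <;> simp [h]

theorem length_le_listCount (L : List ℕ) (h : ∀ a ∈ L, 0 < a) : L.length ≤ listCount L 0 := by
  induction L with
  | nil => simp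
  | cons a L ih =>
    have h1 := ih fun b hb => h b (List.mem_cons_of_mem _ hb)
    have h2 := h a List.mem_cons_self
    rw [listCount_cons, if_pos (dvd_zero a), List.length_cons]
    omega

theorem le_listCount_zero {L : List ℕ} {a : ℕ} (h : a ∈ L) : a ≤ listCount L 0 := by
  rw [listCount_perm (List.perm_cons_erase h), listCount_cons, if_pos (dvd_zero a)]
  omega

theorem IsPermutation.exists_listCount {A : FDDS} (hA : A.IsPermutation) :
    ∃ L : List ℕ, (∀ a ∈ L, 0 < a) ∧ ∀ n, A.fixCount n = listCount L n := by
  induction hk : A.size using Nat.strong_induction_on generalizing A with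
  | _ k ih =>
  rcases isEmpty_or_nonempty A.State with hE | ⟨⟨s⟩⟩
  · refine ⟨[], by simp, fun n => ?_⟩
    simp [listCount, fixCount]
  have hpos := Function.minimalPeriod_pos_of_mem_periodicPts (hA.1.mem_periodicPts s)
  obtain ⟨A', hA', h⟩ := hA.exists_add_iso s
  have hsz := h.fixCount_eq 0
  rw [fixCount_add, fixCount_cycle, if_pos (dvd_zero _), fixCount_zero_right,
    fixCount_zero_right] at hsz
  obtain ⟨L, hL, hc⟩ := ih A'.size (by omega) hA' rfl
  refine ⟨_ :: L, List.forall_mem_cons.2 ⟨hpos, hL⟩, fun n => ?_⟩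
  rw [listCount_cons, ← hc, ← h.fixCount_eq, fixCount_add, fixCount_cycle]

/-- The system that consists of cycles of the given lengths. -/
def ofList (L : List ℕ) : FDDS := L.foldr (fun a S => add (cycle a) S) zero

theorem fixCount_ofList (L : List ℕ) (n : ℕ) : (ofList L).fixCount n = listCount L n := by
  induction L with
  | nil => exact fixCount_zero n
  | cons a L ih => rw [listCount_cons, ← ih, ← fixCount_cycle, ← fixCount_add]; rfl

theorem ofList_isPermutation (L : List ℕ) : (ofList L).IsPermutation := by
  induction L with
  | nil => exact zero_isPermutation
  | cons a L ih => exact (cycle_isPermutation a).add ih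

/-! ### The shortest cycle, read off the counts -/

theorem mem_cycleLengths_of_least {A : FDDS} {l : ℕ} (hl : 0 < l) (hA : 0 < A.fixCount l)
    (h : ∀ n, 0 < n → n < l → A.fixCount n = 0) : l ∈ A.cycleLengths := by
  obtain ⟨s, hs⟩ := (fixCount_pos_iff _ _).1 hA
  have hper : s ∈ Function.periodicPts A.next := ⟨l, hl, hs⟩
  refine ⟨s, hper, le_antisymm
    (Nat.le_of_dvd hl (Function.IsPeriodicPt.minimalPeriod_dvd hs)) (not_lt.1 fun hlt => ?_)⟩
  have h1 := h _ (Function.minimalPeriod_pos_of_mem_periodicPts hper) hlt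
  have h2 := (fixCount_pos_iff A (Function.minimalPeriod A.next s)).2
    ⟨s, Function.iterate_minimalPeriod⟩
  omega

theorem pos_of_mem_cycleLengths {A : FDDS} {l : ℕ} (h : l ∈ A.cycleLengths) :
    0 < l ∧ 0 < A.fixCount l := by
  obtain ⟨s, hs, rfl⟩ := h
  exact ⟨Function.minimalPeriod_pos_of_mem_periodicPts hs,
    (fixCount_pos_iff _ _).2 ⟨s, Function.iterate_minimalPeriod⟩⟩

theorem minLength_eq {A : FDDS} {l : ℕ} (hl : 0 < l) (hA : 0 < A.fixCount l)
    (h : ∀ n, 0 < n → n < l → A.fixCount n = 0) : A.minLength = l := by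
  refine le_antisymm (Nat.sInf_le (mem_cycleLengths_of_least hl hA h)) ?_
  have hm := pos_of_mem_cycleLengths
    (Nat.sInf_mem (s := A.cycleLengths) ⟨l, mem_cycleLengths_of_least hl hA h⟩)
  by_contra hlt
  have := h _ hm.1 (not_le.1 hlt)
  have := hm.2
  omega

theorem le_size_of_least {A : FDDS} {l : ℕ} (hl : 0 < l) (hA : 0 < A.fixCount l)
    (h : ∀ n, 0 < n → n < l → A.fixCount n = 0) : l ≤ A.size := by
  obtain ⟨s, _, rfl⟩ := mem_cycleLengths_of_least hl hA h
  have := Fintype.ofFinite A.State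
  rw [size, Nat.card_eq_fintype_card]
  exact Function.minimalPeriod_le_card

end FDDS

/-! ### The anti-lcm -/

theorem alcm_spec {g b c : ℕ} (h : Nat.lcm g c = b) : Nat.lcm g (alcm g b) = b :=
  Nat.sInf_mem (s := {c | Nat.lcm g c = b}) ⟨c, h⟩

/-- The solutions `c` of `lcm g c = b` are closed under gcd: at each prime this is the
distributivity of max over min. So the gcd of the least solution with any other is again a solution,
and by minimality it equals the least one. -/
theorem alcm_dvd {g b c : ℕ} (hb : 0 < b) (h : Nat.lcm g c = b) : alcm g b ∣ c := by
  have h0 := alcm_spec h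
  have hne {c : ℕ} (h : Nat.lcm g c = b) : g ≠ 0 ∧ c ≠ 0 := by
    constructor <;> rintro rfl <;> simp at h <;> omega
  have hd := (hne h0).2
  set d := alcm g b with hdd
  have hg := (hne h).1
  have hc := (hne h).2
  have hgcd : Nat.gcd d c ≠ 0 := Nat.gcd_ne_zero_left hd
  have key : Nat.lcm g (Nat.gcd d c) = b := by
    apply Nat.eq_of_factorization_eq (Nat.lcm_ne_zero hg hgcd) hb.ne'
    intro p
    have h1 := congrArg (fun m => m.factorization p) h0
    have h2 := congrArg (fun m => m.factorization p) h
    simp only [Nat.factorization_lcm hg hd, Nat.factorization_lcm hg hc, Finsupp.sup_apply]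
      at h1 h2
    rw [Nat.factorization_lcm hg hgcd, Nat.factorization_gcd hd hc, Finsupp.sup_apply,
      Finsupp.inf_apply, sup_inf_left, h1, h2, inf_idem]
  have hle : d ≤ Nat.gcd d c := Nat.sInf_le key
  have : Nat.gcd d c = d := le_antisymm (Nat.le_of_dvd (Nat.pos_of_ne_zero hd)
    (Nat.gcd_dvd_left _ _)) hle
  exact this ▸ Nat.gcd_dvd_right d c

theorem alcm_pos {g b : ℕ} (hb : 0 < b) (h : g ∣ b) : 0 < alcm g b := by
  have := alcm_spec (Nat.lcm_eq_right h)
  rcases Nat.eq_zero_or_pos (alcm g b) with h0 | h0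
  · rw [h0, Nat.lcm_zero_right] at this
    omega
  · exact h0

/-! ### Polynomials on fixed point counts -/

theorem PermGraph.toFDDS_isPermutation (A : PermGraph) : A.toFDDS.IsPermutation := A.next.bijective

theorem PermGraph.size_toFDDS (A : PermGraph) : A.toFDDS.size = A.n := Nat.card_fin A.n

namespace PermPoly

open FDDS

/-- The polynomial that `P` induces on the numbers of fixed points of the `n`-th iterate. -/
noncomputable def peval (P : PermPoly) (n x : ℕ) : ℕ :=
  (P.terms.map fun m => m.2.toFDDS.fixCount n * x ^ m.1).sum

/-- The total number of fixed points of the `n`-th iterates of the coefficients of the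
non-constant monomials. -/
noncomputable def nonconstCount (P : PermPoly) (n : ℕ) : ℕ :=
  (P.terms.map fun m => if m.1 = 0 then 0 else m.2.toFDDS.fixCount n).sum

/-- This splits the equation `P(X) = B` into independent equations between natural numbers, one for
each `n`. -/
theorem fixCount_eval (P : PermPoly) (X : FDDS) (n : ℕ) :
    (P.eval X).fixCount n = P.peval n (X.fixCount n) := by
  rw [eval, peval]
  induction P.terms with
  | nil => exact fixCount_zero n
  | cons m L ih =>
    rw [List.foldr_cons, fixCount_add, fixCount_mul, fixCount_pow, ih, List.map_cons,
      List.sum_cons]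

theorem eval_isPermutation (P : PermPoly) {X : FDDS} (hX : X.IsPermutation) :
    (P.eval X).IsPermutation := by
  rw [eval]
  induction P.terms with
  | nil => exact zero_isPermutation
  | cons m L ih => exact (m.2.toFDDS_isPermutation.mul (hX.pow _)).add ih

theorem nonconstCount_pos_iff (P : PermPoly) (n : ℕ) :
    0 < P.nonconstCount n ↔ ∃ m ∈ P.terms, m.1 ≠ 0 ∧ 0 < m.2.toFDDS.fixCount n := by
  rw [nonconstCount, ← not_iff_not]
  simp only [not_lt, Nat.le_zero, List.sum_eq_zero_iff, List.mem_map, not_exists, not_and]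
  constructor
  · intro h m hm h0
    simpa [h0] using h _ ⟨m, hm, rfl⟩
  · rintro h _ ⟨m, hm, rfl⟩
    split_ifs with h0
    · rfl
    · exact h m hm h0

theorem PseudoInjective.seed_mem {P : PermPoly} (hP : P.PseudoInjective) :
    P.seed ∈ P.nonconstLengths :=
  Nat.sInf_mem hP.1

theorem PseudoInjective.seed_pos {P : PermPoly} (hP : P.PseudoInjective) : 0 < P.seed := by
  obtain ⟨m, _, _, h⟩ := hP.seed_mem
  exact (pos_of_mem_cycleLengths h).1

/-- A cycle has fixed points at `n` only if its length, a multiple of the seed, divides `n`;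
conversely a cycle whose length is the seed does occur. -/
theorem PseudoInjective.nonconstCount_pos {P : PermPoly} (hP : P.PseudoInjective) (n : ℕ) :
    0 < P.nonconstCount n ↔ P.seed ∣ n := by
  rw [nonconstCount_pos_iff]
  constructor
  · rintro ⟨m, hm, hm0, h⟩
    obtain ⟨s, hs⟩ := (fixCount_pos_iff _ _).1 h
    have hper := m.2.toFDDS_isPermutation.1.mem_periodicPts s
    exact (hP.2 _ ⟨m, hm, hm0, s, hper, rfl⟩).trans (Function.IsPeriodicPt.minimalPeriod_dvd hs)
  · intro h
    obtain ⟨m, hm, hm0, s, hs, hl⟩ := hP.seed_mem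
    refine ⟨m, hm, hm0, (fixCount_pos_iff _ _).2 ⟨s, ?_⟩⟩
    exact (Function.isPeriodicPt_minimalPeriod _ s).trans_dvd (hl ▸ h)

theorem peval_strictMono (P : PermPoly) {n : ℕ} (h : 0 < P.nonconstCount n) :
    StrictMono (P.peval n) := by
  intro x y hxy
  obtain ⟨m, hm, hm0, hpos⟩ := (nonconstCount_pos_iff P n).1 h
  refine List.sum_lt_sum _ _ (fun m _ => ?_) ⟨m, hm, ?_⟩
  · exact Nat.mul_le_mul_left _ (Nat.pow_le_pow_left hxy.le _)
  · exact Nat.mul_lt_mul_of_pos_left (Nat.pow_lt_pow_left hxy hm0) hpos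

theorem peval_congr_of_nonconstCount_eq_zero (P : PermPoly) {n : ℕ} (h : P.nonconstCount n = 0)
    (x y : ℕ) : P.peval n x = P.peval n y := by
  have hn : ¬ ∃ m ∈ P.terms, m.1 ≠ 0 ∧ 0 < m.2.toFDDS.fixCount n := by
    rw [← nonconstCount_pos_iff, h]; exact lt_irrefl 0
  unfold peval
  congr 1
  refine List.map_congr_left fun m hm => ?_
  by_cases h0 : m.1 = 0
  · simp [h0]
  · have : m.2.toFDDS.fixCount n = 0 := by
      by_contra hc
      exact hn ⟨m, hm, h0, Nat.pos_of_ne_zero hc⟩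
    simp [this]

/-- The values of `P` at `X + R` and at `X` differ by a permutation. -/
theorem exists_difference (P : PermPoly) {X R : FDDS} (hX : X.IsPermutation)
    (hR : R.IsPermutation) : ∃ D : FDDS, D.IsPermutation ∧
      ∀ n, P.peval n (X.fixCount n + R.fixCount n) = P.peval n (X.fixCount n) + D.fixCount n := by
  have hpow (p : ℕ) : ∃ D : FDDS, D.IsPermutation ∧
      ∀ n, (X.fixCount n + R.fixCount n) ^ p = X.fixCount n ^ p + D.fixCount n := by
    induction p with
    | zero => exact ⟨zero, zero_isPermutation, fun n => by simp [fixCount_zero]⟩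
    | succ p ih =>
      obtain ⟨D, hD, h⟩ := ih
      -- With `D = (X + R)^p - X^p`, the next difference is `D (X + R) + X^p R`, which involves no
      -- subtraction.
      refine ⟨FDDS.add (FDDS.mul D (FDDS.add X R)) (FDDS.mul (FDDS.pow X p) R),
        (hD.mul (hX.add hR)).add ((hX.pow p).mul hR), fun n => ?_⟩
      rw [pow_succ, h, fixCount_add, fixCount_mul, fixCount_mul, fixCount_add, fixCount_pow]
      ring
  unfold peval
  induction P.terms with
  | nil => exact ⟨zero, zero_isPermutation, fun n => by simp [fixCount_zero]⟩
  | cons m L ih =>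
    obtain ⟨D, hD, h⟩ := ih
    obtain ⟨E, hE, h'⟩ := hpow m.1
    refine ⟨FDDS.add (FDDS.mul m.2.toFDDS E) D,
      (m.2.toFDDS_isPermutation.mul hE).add hD, fun n => ?_⟩
    rw [List.map_cons, List.map_cons, List.sum_cons, List.sum_cons, h, h', fixCount_add,
      fixCount_mul]
    ring

/-! ### Correctness of the algorithm -/

/-- Adding to `X` the cycles of the lengths in `R`, all of them anti-lcms with respect to the
seed, gives a solution of `P(X) = B`. -/
structure Completes (P : PermPoly) (B X : FDDS) (R : List ℕ) : Prop where
  normal : ∀ a ∈ R, 0 < a ∧ alcm P.seed (Nat.lcm P.seed a) = a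
  count : ∀ n, P.peval n (X.fixCount n + listCount R n) = B.fixCount n

variable {P : PermPoly} {B X : FDDS} {R : List ℕ}

theorem Completes.erase (h : P.Completes B X R) {X' : FDDS} {a : ℕ} (ha : a ∈ R)
    (hX' : ∀ n, X'.fixCount n = X.fixCount n + if a ∣ n then a else 0) :
    P.Completes B X' (R.erase a) := by
  refine ⟨fun b hb => h.normal b (List.mem_of_mem_erase hb), fun n => ?_⟩
  rw [← h.count n, hX', listCount_perm (List.perm_cons_erase ha), listCount_cons]
  congr 1
  ring

/-- The greedy choice is correct. The length `l` is described twice: as the shortest cycle length of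
the difference `D`, which the algorithm uses, and as the least positive `n` where the count of
`P(X)` is below that of `B`, which the program searches for. -/
theorem Completes.exists_least (hP : P.PseudoInjective) (hB : B.IsPermutation)
    (hX : X.IsPermutation) (h : P.Completes B X R) (hR : R ≠ []) :
    ∃ (l : ℕ) (D : FDDS), 0 < l ∧ P.seed ∣ l ∧ l ≤ B.size ∧ alcm P.seed l ∈ R ∧
      P.peval l (X.fixCount l) < B.fixCount l ∧
      (∀ n, 0 < n → n < l → ¬ P.peval n (X.fixCount n) < B.fixCount n) ∧
      Iso (FDDS.add (P.eval X) D) B ∧ D.size ≠ 0 ∧ D.minLength = l := by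
  classical
  obtain ⟨D, hD, hdiff⟩ := P.exists_difference hX (ofList_isPermutation R)
  simp only [fixCount_ofList, h.count] at hdiff
  -- The count of `D` is the increment of `P_n` caused by `R`: zero if `P_n` is constant or `R` has
  -- no fixed points at `n`, positive otherwise.
  have hpos (n : ℕ) : 0 < D.fixCount n ↔ P.seed ∣ n ∧ ∃ a ∈ R, 0 < a ∧ a ∣ n := by
    rw [← listCount_pos_iff, ← hP.nonconstCount_pos]
    have hn := hdiff n
    rw [← h.count n] at hn
    constructor
    · intro hDn
      refine ⟨?_, ?_⟩
      · by_contra h0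
        have := P.peval_congr_of_nonconstCount_eq_zero (Nat.le_zero.1 (not_lt.1 h0))
          (X.fixCount n + listCount R n) (X.fixCount n)
        omega
      · by_contra h0
        rw [Nat.le_zero.1 (not_lt.1 h0), add_zero] at hn
        omega
    · rintro ⟨h0, h1⟩
      have := P.peval_strictMono h0 (show X.fixCount n < X.fixCount n + listCount R n by omega)
      omega
  have hlcm {a : ℕ} (ha : a ∈ R) : 0 < Nat.lcm P.seed a ∧ 0 < D.fixCount (Nat.lcm P.seed a) :=
    ⟨Nat.lcm_pos hP.seed_pos (h.normal a ha).1,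
      (hpos _).2 ⟨Nat.dvd_lcm_left _ _, a, ha, (h.normal a ha).1, Nat.dvd_lcm_right _ _⟩⟩
  obtain ⟨a₀, ha₀⟩ := List.exists_mem_of_ne_nil R hR
  have hex : ∃ l, 0 < l ∧ 0 < D.fixCount l := ⟨_, hlcm ha₀⟩
  obtain ⟨hl0, hlD⟩ := Nat.find_spec hex
  have hmin (n) (hn0 : 0 < n) (hn : n < Nat.find hex) : D.fixCount n = 0 := by
    have := Nat.find_min hex hn
    simp only [not_and, not_lt] at this
    exact Nat.le_zero.1 (this hn0)
  set l := Nat.find hex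
  obtain ⟨hgl, a, ha, ha0, hal⟩ := (hpos l).1 hlD
  -- `lcm g a` divides `l`, and `D` has fixed points there too, so minimality of `l` gives equality.
  have hla : Nat.lcm P.seed a = l := by
    refine le_antisymm (Nat.le_of_dvd hl0 (Nat.lcm_dvd hgl hal)) ?_
    by_contra hlt
    have := hmin _ (hlcm ha).1 (not_le.1 hlt)
    have := (hlcm ha).2
    omega
  have hDB (n) : D.fixCount n ≤ B.fixCount n := by
    have := hdiff n
    omega
  refine ⟨l, D, hl0, hgl, ?_, ?_, ?_, fun n hn0 hn => ?_, ?_, ?_, minLength_eq hl0 hlD hmin⟩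
  · refine (le_size_of_least hl0 hlD hmin).trans ?_
    rw [← fixCount_zero_right, ← fixCount_zero_right]
    exact hDB 0
  · rw [← hla, (h.normal a ha).2]
    exact ha
  · have := hdiff l
    omega
  · have := hdiff n
    have := hmin n hn0 hn
    omega
  · refine iso_of_fixCount_eq ((P.eval_isPermutation hX).add hD) hB fun n _ => ?_
    rw [fixCount_add, fixCount_eval, hdiff]
  · obtain ⟨s, _⟩ := (fixCount_pos_iff _ _).1 hlD
    have : Nonempty D.State := ⟨s⟩
    exact Nat.card_pos.ne'

theorem Completes.not_lt (h : P.Completes B X []) (n : ℕ) :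
    ¬ P.peval n (X.fixCount n) < B.fixCount n := by
  simp [← h.count n, listCount]

/-- At `n = 0` the counts are sizes, and a strictly increasing function on `ℕ` satisfies `x ≤ f x`.
-/
theorem Completes.listCount_zero_le (hP : P.PseudoInjective) (h : P.Completes B X R) :
    X.size + listCount R 0 ≤ B.size := by
  rw [← fixCount_zero_right, ← fixCount_zero_right, ← h.count 0]
  exact (P.peval_strictMono ((hP.nonconstCount_pos 0).2 (dvd_zero _))).le_apply

/-- Each step moves one element of `R` into `X`, so the count of `X` plus that of `R` is invariant.
The result `Y` is identified by this invariant alone, which lets it be the graph that the program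
builds. -/
theorem Completes.polyCycleFrom (hP : P.PseudoInjective) {B : PermGraph}
    (h : P.Completes B.toFDDS X R) (hX : X.IsPermutation) {Y : PermGraph}
    (hY : ∀ n, Y.toFDDS.fixCount n = X.fixCount n + listCount R n) :
    PolyCycleFrom P B X (some Y) := by
  induction hk : R.length generalizing X R with
  | zero =>
    rw [List.length_eq_zero_iff] at hk
    subst hk
    refine .done X Y ?_ ?_
    · refine iso_of_fixCount_eq (P.eval_isPermutation hX) B.toFDDS_isPermutation fun n _ => ?_
      rw [fixCount_eval, ← h.count n, listCount, List.map_nil, List.sum_nil, add_zero]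
    · refine iso_of_fixCount_eq hX Y.toFDDS_isPermutation fun n _ => ?_
      rw [hY, listCount, List.map_nil, List.sum_nil, add_zero]
  | succ k ih =>
    obtain ⟨l, D, -, hgl, -, ha, -, -, hiso, hD0, rfl⟩ :=
      h.exists_least hP B.toFDDS_isPermutation hX (by rintro rfl; simp at hk)
    refine .step X D _ hiso hD0 hgl (ih (h.erase ha fun n => ?_) (hX.add (cycle_isPermutation _))
      (fun n => ?_) (by rw [List.length_erase_of_mem ha, hk, Nat.add_sub_cancel]))
    · rw [fixCount_add, fixCount_cycle]
    · rw [hY, fixCount_add, fixCount_cycle, listCount_perm (List.perm_cons_erase ha),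
        listCount_cons, add_assoc]

/-- Every solution can be replaced by one whose cycle lengths are anti-lcms. -/
theorem exists_completes (hP : P.PseudoInjective) (hX : X.IsPermutation)
    (h : Iso (P.eval X) B) : ∃ R, P.Completes B zero R := by
  obtain ⟨L, hL, hc⟩ := hX.exists_listCount
  set g := P.seed with hg
  have hg0 : 0 < g := hP.seed_pos
  have key : ∃ R : List ℕ, (∀ a ∈ R, 0 < a ∧ alcm g (Nat.lcm g a) = a) ∧
      ∀ n, g ∣ n → listCount R n = listCount L n := by
    clear hc
    induction L with
    | nil => exact ⟨[], by simp, fun _ _ => rfl⟩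
    | cons c L ih =>
      obtain ⟨R, hR, hRL⟩ := ih fun a ha => hL a (List.mem_cons_of_mem _ ha)
      have hc0 : 0 < c := hL c List.mem_cons_self
      set b := Nat.lcm g c with hb
      have hb0 : 0 < b := Nat.lcm_pos hg0 hc0
      set a := alcm g b with ha
      have hab : Nat.lcm g a = b := alcm_spec hb.symm
      have hac : a ∣ c := alcm_dvd hb0 hb.symm
      have ha0 : 0 < a := Nat.pos_of_dvd_of_pos hac hc0
      refine ⟨List.replicate (c / a) a ++ R, ?_, fun n hn => ?_⟩
      · intro d hd
        rcases List.mem_append.1 hd with hd | hd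
        · rw [List.eq_of_mem_replicate hd, hab]
          exact ⟨ha0, rfl⟩
        · exact hR d hd
      · have hiff : a ∣ n ↔ c ∣ n := by
          constructor
          · intro h1
            exact (Nat.dvd_lcm_right g c).trans (hb ▸ hab ▸ Nat.lcm_dvd hn h1)
          · exact hac.trans
        rw [listCount_cons, ← hRL n hn, listCount, List.map_append, List.sum_append,
          List.map_replicate, List.sum_replicate, smul_eq_mul]
        simp only [hiff, listCount]
        split_ifs with h1
        · rw [Nat.div_mul_cancel hac]
        · rfl
  obtain ⟨R, hR, hRL⟩ := key
  refine ⟨R, hR, fun n => ?_⟩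
  rw [← h.fixCount_eq, fixCount_eval, fixCount_zero, zero_add, hc]
  by_cases hn : g ∣ n
  · rw [hRL n hn]
  · refine P.peval_congr_of_nonconstCount_eq_zero ?_ _ _
    exact Nat.le_zero.1 (not_lt.1 fun h => hn ((hP.nonconstCount_pos n).1 h))

/-- If no failure condition holds, the difference is nonempty, as otherwise `X` would be a solution;
so a cycle of positive length is added. Since `|X| ≤ |P(X)| ≤ |B|`, this happens finitely often. -/
theorem polyCycleFrom_none (hP : P.PseudoInjective) {B : PermGraph}
    (h : ∀ X : FDDS, X.IsPermutation → ¬ Iso (P.eval X) B.toFDDS) (hX : X.IsPermutation) :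
    PolyCycleFrom P B X none := by
  induction hk : B.n + 1 - X.size using Nat.strong_induction_on generalizing X with
  | _ k ih =>
  by_cases hsub : FDDS.Sub (P.eval X) B.toFDDS
  swap
  · exact .exceeded X (Or.inr hsub)
  obtain ⟨D, hD⟩ := hsub
  -- `D` is an arbitrary system, but its map is a restriction of an injective one on a finite set.
  have hDp : D.IsPermutation := by
    have h1 := hD.isPermutation B.toFDDS_isPermutation
    refine Finite.injective_iff_bijective.1 fun s t hst => ?_
    exact Sum.inr_injective (h1.1 (a₁ := Sum.inr s) (a₂ := Sum.inr t) (congrArg Sum.inr hst))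
  have hXle : X.size ≤ B.n := by
    have h0 := hD.fixCount_eq 0
    rw [fixCount_add, fixCount_eval, fixCount_zero_right, fixCount_zero_right,
      fixCount_zero_right, B.size_toFDDS] at h0
    have := (P.peval_strictMono ((hP.nonconstCount_pos 0).2 (dvd_zero _))).le_apply (x := X.size)
    omega
  by_cases hD0 : D.size = 0
  · refine (h X hX (iso_of_fixCount_eq (P.eval_isPermutation hX)
      B.toFDDS_isPermutation fun n _ => ?_)).elim
    have hE : IsEmpty D.State := by
      rcases Nat.card_eq_zero.1 hD0 with h | h
      · exact h
      · exact (h.not_finite inferInstance).elim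
    rw [← hD.fixCount_eq, fixCount_add, FDDS.fixCount.eq_1 D, Nat.card_of_isEmpty, add_zero]
  by_cases hg : P.seed ∣ D.minLength
  swap
  · exact .noAlcm X D hD hD0 hg
  have hl : 0 < D.minLength := by
    obtain ⟨s⟩ := (Nat.card_pos_iff.1 (Nat.pos_of_ne_zero hD0)).1
    exact (pos_of_mem_cycleLengths (Nat.sInf_mem (s := D.cycleLengths)
      ⟨_, s, hDp.1.mem_periodicPts s, rfl⟩)).1
  have ha := alcm_pos hl hg
  refine .step X D none hD hD0 hg (ih _ ?_ (hX.add (cycle_isPermutation _)) rfl)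
  rw [← fixCount_zero_right (FDDS.add _ _), fixCount_add, fixCount_cycle, if_pos (dvd_zero _),
    fixCount_zero_right]
  omega

end PermPoly

/-! ### Computing functions of the store in polynomial time

All loops below run at most as often as the number in the register `0` says. -/

/-- `s'` has the same arrays as `s` and the same registers below `r`. -/
def Store.Agree (r : ℕ) (s s' : Store) : Prop := s'.arr = s.arr ∧ ∀ i < r, s'.reg i = s.reg i

theorem Store.Agree.mono {r r' : ℕ} {s s' : Store} (h : Store.Agree r' s s') (hr : r ≤ r') :
    Store.Agree r s s' :=
  ⟨h.1, fun i hi => h.2 i (hi.trans_le hr)⟩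

theorem Store.Agree.trans {r : ℕ} {s s' s'' : Store} (h : Store.Agree r s s')
    (h' : Store.Agree r s' s'') : Store.Agree r s s'' :=
  ⟨h'.1.trans h.1, fun i hi => (h'.2 i hi).trans (h.2 i hi)⟩

theorem Store.reg_setReg (s : Store) (i v j : ℕ) :
    (s.setReg i v).reg j = if j = i then v else s.reg j := by
  simp [Store.setReg, Function.update_apply]

theorem Store.arr_setReg (s : Store) (i v : ℕ) : (s.setReg i v).arr = s.arr := rfl

theorem Store.Agree.setReg {r i : ℕ} (s : Store) (h : r ≤ i) (v : ℕ) :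
    Store.Agree r s (s.setReg i v) :=
  ⟨rfl, fun j hj => by rw [Store.reg_setReg, if_neg (by omega)]⟩

/-- `f` reads the registers below `r` and the arrays only, and for every `r' ≥ r` a program writes
its value to the register `r'`, without changing the arrays and the registers below `r'`, in time
polynomial in the register `0`. -/
structure Cmp (r : ℕ) (f : Store → ℕ) : Prop where
  pos : 0 < r
  reads : ∀ s s', Store.Agree r s s' → f s' = f s
  exec : ∀ r' ≥ r, ∃ (p : Prog) (q : Polynomial ℕ), ∀ s, ∃ t s', Exec p s t s' ∧
    t ≤ q.eval (s.reg 0) ∧ Store.Agree r' s s' ∧ s'.reg r' = f s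

/-- `F` reads the registers below `r` and the arrays only, and for every `r' ≥ r` a program replaces
the arrays by `F`, without changing the registers below `r'`, in time polynomial in the
register `0`. -/
structure Act (r : ℕ) (F : Store → ℕ → ℕ → ℕ) : Prop where
  pos : 0 < r
  reads : ∀ s s', Store.Agree r s s' → F s' = F s
  exec : ∀ r' ≥ r, ∃ (p : Prog) (q : Polynomial ℕ), ∀ s, ∃ t s', Exec p s t s' ∧
    t ≤ q.eval (s.reg 0) ∧ s'.arr = F s ∧ ∀ i < r', s'.reg i = s.reg i

/-- Apply `f (k - 1)`, …, `f 0` in this order. -/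
def loopDown {α : Type} (f : ℕ → α → α) : ℕ → α → α
  | 0, x => x
  | k + 1, x => loopDown f k (f k x)

/-- Register `d` only supplies the constant `1` for the decrement. Each round costs the body, two
assignments and a test, hence `T + 3`; the last `1` is the exit test. -/
theorem exec_countdown {c d : ℕ} {p : Prog} {I : ℕ → Store → Prop} {T : ℕ}
    (h : ∀ k s, I (k + 1) s → s.reg c = k + 1 → ∃ t s',
      Exec p ((s.setReg d 1).setReg c k) t s' ∧ t ≤ T ∧ I k s' ∧ s'.reg c = k) (hcd : c ≠ d) :
    ∀ k s, I k s → s.reg c = k → ∃ t s',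
      Exec (.loop c (.seq (.const d 1) (.seq (.sub c c d) p))) s t s' ∧
        t ≤ k * (T + 3) + 1 ∧ I 0 s' := by
  intro k
  induction k with
  | zero => exact fun s hI hc => ⟨1, s, .loop_exit hc, by omega, hI⟩
  | succ k ih =>
    intro s hI hc
    obtain ⟨t, s', he, ht, hI', hc'⟩ := h k s hI hc
    obtain ⟨t', s'', he', ht', hI''⟩ := ih s' hI' hc'
    have hs : Exec (.sub c c d) (s.setReg d 1) 1 ((s.setReg d 1).setReg c k) := by
      have := Exec.sub c c d (s.setReg d 1)
      rwa [Store.reg_setReg, Store.reg_setReg, if_neg hcd, if_pos rfl, hc,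
        Nat.add_sub_cancel] at this
    refine ⟨_, s'', .loop_step (by omega) (.seq (.const d 1 s) (.seq hs he)) he', ?_, hI''⟩
    have : (k + 1) * (T + 3) = k * (T + 3) + (T + 3) := by ring
    omega

/-! ### Values computable in polynomial time -/

namespace Cmp

variable {r : ℕ} {f g h : Store → ℕ}

theorem mono (hf : Cmp r f) {R : ℕ} (hR : r ≤ R) : Cmp R f where
  pos := hf.pos.trans_le hR
  reads s s' hs := hf.reads s s' (hs.mono hR)
  exec r' hr' := hf.exec r' (hR.trans hr')

theorem const (hr : 0 < r) (c : ℕ) : Cmp r fun _ => c where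
  pos := hr
  reads _ _ _ := rfl
  exec r' _ := ⟨.const r' c, 1, fun s => ⟨1, _, .const r' c s, by simp,
    Store.Agree.setReg s le_rfl c, by simp [Store.reg_setReg]⟩⟩

theorem reg {i : ℕ} (hi : i < r) : Cmp r fun s => s.reg i where
  pos := by omega
  reads s s' hs := hs.2 i hi
  exec r' hr' := ⟨.seq (.const r' 0) (.add r' i r'), 2, fun s => ⟨_, _,
    .seq (.const _ _ _) (.add _ _ _ _), by simp,
    (Store.Agree.setReg s le_rfl 0).trans (Store.Agree.setReg _ le_rfl _), by
      simp [Store.reg_setReg, show i ≠ r' by omega]⟩⟩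

/-- Two values are computed one after the other and combined by an instruction. -/
theorem binop (hf : Cmp r f) (hg : Cmp r g) (o : ℕ → ℕ → ℕ) (op : ℕ → ℕ → ℕ → Prog)
    (hop : ∀ i j k s, Exec (op i j k) s 1 (s.setReg i (o (s.reg j) (s.reg k)))) :
    Cmp r fun s => o (f s) (g s) where
  pos := hf.pos
  reads s s' hs := by rw [hf.reads s s' hs, hg.reads s s' hs]
  exec r' hr' := by
    obtain ⟨p, q, hp⟩ := hf.exec r' hr'
    obtain ⟨p', q', hp'⟩ := hg.exec (r' + 1) (by omega)
    refine ⟨.seq p (.seq p' (op r' r' (r' + 1))), q + q' + 1, fun s => ?_⟩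
    obtain ⟨t, s1, e, ht, ha, hv⟩ := hp s
    obtain ⟨t', s2, e', ht', ha', hv'⟩ := hp' s1
    refine ⟨_, _, .seq e (.seq e' (hop _ _ _ _)), ?_,
      (ha.trans (ha'.mono (by omega))).trans (Store.Agree.setReg _ le_rfl _), ?_⟩
    · rw [ha.2 0 (hf.pos.trans_le hr')] at ht'
      simp only [Polynomial.eval_add, Polynomial.eval_one]
      omega
    · rw [Store.reg_setReg, if_pos rfl, hv', ha'.2 r' (by omega), hv,
        hg.reads s s1 (ha.mono hr')]

theorem add (hf : Cmp r f) (hg : Cmp r g) : Cmp r fun s => f s + g s :=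
  binop hf hg (· + ·) .add fun i j k s => .add i j k s

theorem sub (hf : Cmp r f) (hg : Cmp r g) : Cmp r fun s => f s - g s :=
  binop hf hg (· - ·) .sub fun i j k s => .sub i j k s

theorem load (a : ℕ) (hf : Cmp r f) : Cmp r fun s => s.arr a (f s) where
  pos := hf.pos
  reads s s' hs := by rw [hf.reads s s' hs, hs.1]
  exec r' hr' := by
    obtain ⟨p, q, hp⟩ := hf.exec r' hr'
    refine ⟨.seq p (.load r' a r'), q + 1, fun s => ?_⟩
    obtain ⟨t, s1, e, ht, ha, hv⟩ := hp s
    refine ⟨_, _, .seq e (.load _ _ _ _), by simpa using ht,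
      ha.trans (Store.Agree.setReg _ le_rfl _), ?_⟩
    rw [Store.reg_setReg, if_pos rfl, hv, ha.1]

theorem ite (hh : Cmp r h) (hf : Cmp r f) (hg : Cmp r g) :
    Cmp r fun s => if h s = 0 then f s else g s where
  pos := hf.pos
  reads s s' hs := by rw [hf.reads s s' hs, hg.reads s s' hs, hh.reads s s' hs]
  exec r' hr' := by
    obtain ⟨p, q, hp⟩ := hh.exec r' hr'
    obtain ⟨p1, q1, hp1⟩ := hf.exec r' hr'
    obtain ⟨p2, q2, hp2⟩ := hg.exec r' hr'
    refine ⟨.seq p (.ite r' p2 p1), q + q1 + q2 + 1, fun s => ?_⟩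
    obtain ⟨t, s1, e, ht, ha, hv⟩ := hp s
    have h0 := ha.2 0 (hf.pos.trans_le hr')
    simp only [Polynomial.eval_add, Polynomial.eval_one]
    by_cases hc : h s = 0
    · obtain ⟨t', s2, e', ht', ha', hv'⟩ := hp1 s1
      rw [h0] at ht'
      refine ⟨_, _, .seq e (.ite_false (hv.trans hc) e'), by omega, ha.trans ha', ?_⟩
      rw [hv', hf.reads s s1 (ha.mono hr'), if_pos hc]
    · obtain ⟨t', s2, e', ht', ha', hv'⟩ := hp2 s1
      rw [h0] at ht'
      refine ⟨_, _, .seq e (.ite_true (hv ▸ hc) e'), by omega, ha.trans ha', ?_⟩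
      rw [hv', hg.reads s s1 (ha.mono hr'), if_neg hc]

theorem min (hf : Cmp r f) (hg : Cmp r g) : Cmp r fun s => min (f s) (g s) := by
  have := hf.sub (hf.sub hg)
  simpa only [show ∀ a b : ℕ, a - (a - b) = Min.min a b by omega] using this

/-- The distance of two values; it is `0` if and only if they are equal. -/
theorem dist (hf : Cmp r f) (hg : Cmp r g) : Cmp r fun s => Nat.dist (f s) (g s) :=
  (hf.sub hg).add (hg.sub hf)

/-- Register `0` caps the rounds and is preserved by the body, so the body's time bound is the same
in every round. The accumulator is in `r'`, the counter in `r' + 1`, and the body's value appears in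
`r' + 2`. The hypothesis on `b` admits arbitrary computable arguments so that these registers can be
substituted. -/
theorem loop {n x : Store → ℕ} {b : ℕ → ℕ → Store → ℕ} (hn : Cmp r n) (hx : Cmp r x)
    (hb : ∀ R ≥ r, ∀ v w, Cmp R v → Cmp R w → Cmp R fun s => b (v s) (w s) s) :
    Cmp r fun s => loopDown (fun i y => b i y s) (Min.min (n s) (s.reg 0)) (x s) := by
  have hb0 {s s'} (hs : Store.Agree r s s') (i y) : b i y s' = b i y s :=
    (hb r le_rfl _ _ (const hn.pos i) (const hn.pos y)).reads s s' hs
  have hm := hn.min (reg hn.pos)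
  refine ⟨hn.pos, fun s s' hs => ?_, fun r' hr' => ?_⟩
  · rw [hm.reads s s' hs, hx.reads s s' hs]
    congr 1
    funext i y
    exact hb0 hs i y
  obtain ⟨px, qx, hpx⟩ := hx.exec r' hr'
  obtain ⟨pn, qn, hpn⟩ := hm.exec (r' + 1) (by omega)
  obtain ⟨pb, qb, hpb⟩ := (hb (r' + 2) (by omega) _ _ (reg (show r' + 1 < r' + 2 by omega))
    (reg (show r' < r' + 2 by omega))).exec (r' + 2) le_rfl
  refine ⟨.seq px (.seq pn (.loop (r' + 1) (.seq (.const (r' + 2) 1) (.seq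
    (.sub (r' + 1) (r' + 1) (r' + 2)) (.seq pb (.seq (.const (r' + 3) 0)
      (.add r' (r' + 2) (r' + 3)))))))), qx + qn + (Polynomial.X * (qb + 2 + 3) + 1),
    fun s => ?_⟩
  obtain ⟨t1, s1, e1, ht1, ha1, hv1⟩ := hpx s
  obtain ⟨t2, s2, e2, ht2, ha2, hv2⟩ := hpn s1
  have ha12 : Store.Agree r' s s2 := ha1.trans (ha2.mono (by omega))
  have h0 : 0 < r' := hn.pos.trans_le hr'
  set L := fun i y => b i y s
  have hloop := exec_countdown (c := r' + 1) (d := r' + 2)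
    (p := .seq pb (.seq (.const (r' + 3) 0) (.add r' (r' + 2) (r' + 3))))
    (I := fun k s' => Store.Agree r' s s' ∧
      loopDown L k (s'.reg r') = loopDown L (Min.min (n s) (s.reg 0)) (x s))
    (T := qb.eval (s.reg 0) + 2)
  replace hloop := hloop (by
    rintro k s' ⟨ha, hv⟩ hc
    obtain ⟨t, s'', e, ht, ha', hv'⟩ := hpb ((s'.setReg (r' + 2) 1).setReg (r' + 1) k)
    have ha1' : Store.Agree r' s' ((s'.setReg (r' + 2) 1).setReg (r' + 1) k) :=
      (Store.Agree.setReg _ (by omega) _).trans (Store.Agree.setReg _ (by omega) _)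
    have ha2' := (ha.trans ha1').trans (ha'.mono (show r' ≤ r' + 2 by omega))
    refine ⟨_, _, .seq e (.seq (.const _ _ _) (.add _ _ _ _)), ?_, ⟨?_, ?_⟩, ?_⟩
    · rw [(ha.trans ha1').2 0 h0] at ht
      omega
    · exact (ha2'.trans (Store.Agree.setReg _ (by omega) _)).trans (Store.Agree.setReg _ le_rfl _)
    · rw [← hv, loopDown]
      simp only [Store.reg_setReg] at hv' ⊢
      simp only [if_pos, hv', show r' + 2 ≠ r' + 3 by omega, show r' ≠ r' + 1 by omega,
        show r' ≠ r' + 2 by omega, if_false, add_zero]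
      rw [hb0 ((ha.trans ha1').mono hr')]
    · have := ha'.2 (r' + 1) (by omega)
      simp only [Store.reg_setReg] at this ⊢
      simpa using this)
  obtain ⟨t3, s3, e3, ht3, ha3, hv3⟩ := hloop (by omega)
    (Min.min (n s) (s.reg 0)) s2
    ⟨ha12, by rw [ha2.2 r' (by omega), hv1]⟩ (by rw [hv2, hm.reads s s1 (ha1.mono hr')])
  refine ⟨_, _, .seq e1 (.seq e2 e3), ?_, ha3, hv3⟩
  rw [ha1.2 0 h0] at ht2
  have : Min.min (n s) (s.reg 0) * (qb.eval (s.reg 0) + 2 + 3) ≤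
    s.reg 0 * (qb.eval (s.reg 0) + 2 + 3) := Nat.mul_le_mul_right _ (min_le_right _ _)
  simp only [Polynomial.eval_add, Polynomial.eval_mul, Polynomial.eval_X, Polynomial.eval_one,
    Polynomial.eval_ofNat]
  omega

theorem iterate {n x : Store → ℕ} {b : ℕ → Store → ℕ} (hn : Cmp r n) (hx : Cmp r x)
    (hb : ∀ R ≥ r, ∀ w, Cmp R w → Cmp R fun s => b (w s) s) :
    Cmp r fun s => (fun y => b y s)^[Min.min (n s) (s.reg 0)] (x s) := by
  have key (β : ℕ → ℕ) (k y) : loopDown (fun _ y => β y) k y = β^[k] y := by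
    induction k generalizing y with
    | zero => rfl
    | succ k ih => rw [loopDown, ih, Function.iterate_succ_apply]
  have := loop (b := fun _ y s => b y s) hn hx fun R hR _ w _ hw => hb R hR w hw
  simpa only [key] using this

theorem sum {n : Store → ℕ} {b : ℕ → Store → ℕ} (hn : Cmp r n)
    (hb : ∀ R ≥ r, ∀ v, Cmp R v → Cmp R fun s => b (v s) s) :
    Cmp r fun s => ∑ i ∈ Finset.range (Min.min (n s) (s.reg 0)), b i s := by
  have key (β : ℕ → ℕ) (k y) : loopDown (fun i y => y + β i) k y =
      y + ∑ i ∈ Finset.range k, β i := by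
    induction k generalizing y with
    | zero => rfl
    | succ k ih => rw [loopDown, ih, Finset.sum_range_succ]; ring
  have := loop (b := fun i y s => y + b i s) hn (const hn.pos 0) fun R hR v w hv hw =>
    hw.add (hb R hR v hv)
  simpa only [key, zero_add] using this

end Cmp

/-- The least `b ∈ {1, …, K}` with `f b = 0`; it is `0` if there is none. -/
def search (f : ℕ → ℕ) (K : ℕ) : ℕ := loopDown (fun i y => if f (i + 1) = 0 then i + 1 else y) K 0

/-- Candidates are visited downwards, so a smaller zero overwrites a larger one. -/
theorem search_spec (f : ℕ → ℕ) (K : ℕ) :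
    (search f K = 0 ∧ ∀ b, 0 < b → b ≤ K → f b ≠ 0) ∨
      (0 < search f K ∧ search f K ≤ K ∧ f (search f K) = 0 ∧
        ∀ b, 0 < b → b < search f K → f b ≠ 0) := by
  have key (k y) : ((loopDown (fun i y => if f (i + 1) = 0 then i + 1 else y) k y = y ∧
      ∀ b, 0 < b → b ≤ k → f b ≠ 0) ∨ ∃ m, loopDown (fun i y => if f (i + 1) = 0 then i + 1 else y)
        k y = m ∧ 0 < m ∧ m ≤ k ∧ f m = 0 ∧ ∀ b, 0 < b → b < m → f b ≠ 0) := by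
    induction k generalizing y with
    | zero => exact Or.inl ⟨rfl, fun b h1 h2 => by omega⟩
    | succ k ih =>
      rw [loopDown]
      rcases ih (if f (k + 1) = 0 then k + 1 else y) with ⟨h1, h2⟩ | ⟨m, h1, h2, h3, h4⟩
      · by_cases hk : f (k + 1) = 0
        · exact Or.inr ⟨k + 1, by rw [h1, if_pos hk], by omega, le_rfl, hk,
            fun b hb hb' => h2 b hb (by omega)⟩
        · refine Or.inl ⟨by rw [h1, if_neg hk], fun b hb hb' => ?_⟩
          rcases Nat.lt_or_ge k b with h | h
          · rwa [show b = k + 1 by omega]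
          · exact h2 b hb h
      · exact Or.inr ⟨m, h1, h2, by omega, h4⟩
  rcases key K 0 with h | ⟨m, h1, h⟩
  · exact Or.inl h
  · exact Or.inr (by rw [search, h1]; exact h)

theorem search_eq {f : ℕ → ℕ} {K b : ℕ} (hb : 0 < b) (hbK : b ≤ K) (h : f b = 0)
    (hmin : ∀ c, 0 < c → c < b → f c ≠ 0) : search f K = b := by
  rcases search_spec f K with ⟨-, h1⟩ | ⟨h1, -, h2, h3⟩
  · exact (h1 b hb hbK h).elim
  · rcases lt_trichotomy (search f K) b with h4 | h4 | h4
    · exact (hmin _ h1 h4 h2).elim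
    · exact h4
    · exact (h3 b hb h4 h).elim

theorem search_eq_zero {f : ℕ → ℕ} {K : ℕ} (h : ∀ b, 0 < b → b ≤ K → f b ≠ 0) :
    search f K = 0 := by
  rcases search_spec f K with h1 | ⟨h1, h2, h3, -⟩
  · exact h1.1
  · exact (h _ h1 h2 h3).elim

theorem Cmp.search {r : ℕ} {b : ℕ → Store → ℕ} (hr : 0 < r)
    (hb : ∀ R ≥ r, ∀ v, Cmp R v → Cmp R fun s => b (v s) s) :
    Cmp r fun s => search (fun i => b i s) (s.reg 0) := by
  have := Cmp.loop (b := fun i y s => if b (i + 1) s = 0 then i + 1 else y) (Cmp.reg hr)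
    (Cmp.const hr 0) fun R hR v w hv hw =>
      (hb R hR (fun s => v s + 1) (hv.add (.const (hr.trans_le hR) 1))).ite
        (hv.add (.const (hr.trans_le hR) 1)) hw
  simpa only [min_self, _root_.search] using this

/-! ### Array transformations computable in polynomial time -/

namespace Act

variable {r : ℕ} {F G : Store → ℕ → ℕ → ℕ} {f g h : Store → ℕ}

theorem skip (hr : 0 < r) : Act r fun s => s.arr where
  pos := hr
  reads _ _ hs := hs.1
  exec r' _ := ⟨.const r' 0, 1, fun s => ⟨1, _, .const r' 0 s, by simp, rfl,
    (Store.Agree.setReg s le_rfl 0).2⟩⟩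

theorem store (a : ℕ) (hf : Cmp r f) (hg : Cmp r g) :
    Act r fun s => Function.update s.arr a (Function.update (s.arr a) (f s) (g s)) where
  pos := hf.pos
  reads s s' hs := by rw [hf.reads s s' hs, hg.reads s s' hs, hs.1]
  exec r' hr' := by
    obtain ⟨p, q, hp⟩ := hf.exec r' hr'
    obtain ⟨p', q', hp'⟩ := hg.exec (r' + 1) (by omega)
    refine ⟨.seq p (.seq p' (.store a r' (r' + 1))), q + q' + 1, fun s => ?_⟩
    obtain ⟨t, s1, e, ht, ha, hv⟩ := hp s
    obtain ⟨t', s2, e', ht', ha', hv'⟩ := hp' s1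
    refine ⟨_, _, .seq e (.seq e' (.store _ _ _ _)), ?_, ?_,
      (ha.trans (ha'.mono (by omega))).2⟩
    · rw [ha.2 0 (hf.pos.trans_le hr')] at ht'
      simp only [Polynomial.eval_add, Polynomial.eval_one]
      omega
    · rw [Store.setCell, hv', ha'.2 r' (by omega), hv, hg.reads s s1 (ha.mono hr'), ha'.1, ha.1]

theorem seq (hF : Act r F) (hG : Act r G) : Act r fun s => G ⟨s.reg, F s⟩ where
  pos := hF.pos
  reads s s' hs := by
    rw [hF.reads s s' hs]
    exact hG.reads _ _ ⟨rfl, hs.2⟩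
  exec r' hr' := by
    obtain ⟨p, q, hp⟩ := hF.exec r' hr'
    obtain ⟨p', q', hp'⟩ := hG.exec r' hr'
    refine ⟨.seq p p', q + q', fun s => ?_⟩
    obtain ⟨t, s1, e, ht, ha, hv⟩ := hp s
    obtain ⟨t', s2, e', ht', ha', hv'⟩ := hp' s1
    refine ⟨_, _, .seq e e', ?_, ?_, fun i hi => (hv' i hi).trans (hv i hi)⟩
    · rw [hv 0 (hF.pos.trans_le hr')] at ht'
      simp only [Polynomial.eval_add]
      omega
    · rw [ha']
      exact hG.reads ⟨s.reg, F s⟩ s1 ⟨ha, fun i hi => hv i (hi.trans_le hr')⟩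

theorem ite (hh : Cmp r h) (hF : Act r F) (hG : Act r G) :
    Act r fun s => if h s = 0 then F s else G s where
  pos := hF.pos
  reads s s' hs := by rw [hF.reads s s' hs, hG.reads s s' hs, hh.reads s s' hs]
  exec r' hr' := by
    obtain ⟨p, q, hp⟩ := hh.exec r' hr'
    obtain ⟨p1, q1, hp1⟩ := hF.exec r' hr'
    obtain ⟨p2, q2, hp2⟩ := hG.exec r' hr'
    refine ⟨.seq p (.ite r' p2 p1), q + q1 + q2 + 1, fun s => ?_⟩
    obtain ⟨t, s1, e, ht, ha, hv⟩ := hp s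
    have h0 := ha.2 0 (hF.pos.trans_le hr')
    simp only [Polynomial.eval_add, Polynomial.eval_one]
    by_cases hc : h s = 0
    · obtain ⟨t', s2, e', ht', ha', hv'⟩ := hp1 s1
      rw [h0] at ht'
      refine ⟨_, _, .seq e (.ite_false (hv.trans hc) e'), by omega, ?_,
        fun i hi => (hv' i hi).trans (ha.2 i hi)⟩
      rw [ha', hF.reads s s1 (ha.mono hr'), if_pos hc]
    · obtain ⟨t', s2, e', ht', ha', hv'⟩ := hp2 s1
      rw [h0] at ht'
      refine ⟨_, _, .seq e (.ite_true (hv ▸ hc) e'), by omega, ?_,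
        fun i hi => (hv' i hi).trans (ha.2 i hi)⟩
      rw [ha', hG.reads s s1 (ha.mono hr'), if_neg hc]

/-- A value is computed once and kept while the arrays change. -/
theorem bind {b : ℕ → Store → ℕ → ℕ → ℕ} (hf : Cmp r f)
    (hb : ∀ R ≥ r, ∀ v, Cmp R v → (∀ s a, v ⟨s.reg, a⟩ = v s) → Act R fun s => b (v s) s) :
    Act r fun s => b (f s) s where
  pos := hf.pos
  reads s s' hs := by
    rw [hf.reads s s' hs]
    exact (hb r le_rfl _ (.const hf.pos (f s)) fun _ _ => rfl).reads s s' hs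
  exec r' hr' := by
    obtain ⟨p, q, hp⟩ := hf.exec r' hr'
    obtain ⟨p', q', hp'⟩ := (hb (r' + 1) (by omega) _ (.reg (show r' < r' + 1 by omega))
      fun _ _ => rfl).exec (r' + 1) le_rfl
    refine ⟨.seq p p', q + q', fun s => ?_⟩
    obtain ⟨t, s1, e, ht, ha, hv⟩ := hp s
    obtain ⟨t', s2, e', ht', ha', hv'⟩ := hp' s1
    refine ⟨_, _, .seq e e', ?_, ?_, fun i hi => (hv' i (by omega)).trans (ha.2 i hi)⟩
    · rw [ha.2 0 (hf.pos.trans_le hr')] at ht'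
      simp only [Polynomial.eval_add]
      omega
    · rw [ha', hv]
      exact (hb r le_rfl _ (.const hf.pos (f s)) fun _ _ => rfl).reads s s1 (ha.mono hr')

/-- Here the arrays are the accumulator, so only a counter is needed. The index passed to the body
must not depend on the arrays, which change while it is in use; a register qualifies. -/
theorem loop {n : Store → ℕ} {b : ℕ → Store → ℕ → ℕ → ℕ} (hn : Cmp r n)
    (hb : ∀ R ≥ r, ∀ v, Cmp R v → (∀ s a, v ⟨s.reg, a⟩ = v s) → Act R fun s => b (v s) s) :
    Act r fun s => loopDown (fun i a => b i ⟨s.reg, a⟩) (min (n s) (s.reg 0)) s.arr := by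
  have hb0 {s s'} (hs : Store.Agree r s s') (i) : b i s' = b i s :=
    (hb r le_rfl _ (.const hn.pos i) fun _ _ => rfl).reads s s' hs
  have hm := hn.min (.reg hn.pos)
  refine ⟨hn.pos, fun s s' hs => ?_, fun r' hr' => ?_⟩
  · rw [hm.reads s s' hs, hs.1]
    congr 1
    funext i a
    exact hb0 (s := ⟨s.reg, a⟩) (s' := ⟨s'.reg, a⟩) ⟨rfl, hs.2⟩ i
  obtain ⟨pn, qn, hpn⟩ := hm.exec r' hr'
  obtain ⟨pb, qb, hpb⟩ := (hb (r' + 1) (by omega) _ (.reg (show r' < r' + 1 by omega))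
    fun _ _ => rfl).exec (r' + 1) le_rfl
  refine ⟨.seq pn (.loop r' (.seq (.const (r' + 1) 1) (.seq (.sub r' r' (r' + 1)) pb))),
    qn + (Polynomial.X * (qb + 3) + 1), fun s => ?_⟩
  obtain ⟨t2, s2, e2, ht2, ha2, hv2⟩ := hpn s
  have h0 : 0 < r' := hn.pos.trans_le hr'
  set L := fun i a => b i ⟨s.reg, a⟩
  have hloop := exec_countdown (c := r') (d := r' + 1) (p := pb)
    (I := fun k s' => (∀ i < r', s'.reg i = s.reg i) ∧
      loopDown L k s'.arr = loopDown L (min (n s) (s.reg 0)) s.arr)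
    (T := qb.eval (s.reg 0))
  replace hloop := hloop (by
    rintro k s' ⟨ha, hv⟩ hc
    obtain ⟨t, s'', e, ht, ha', hv'⟩ := hpb ((s'.setReg (r' + 1) 1).setReg r' k)
    have ha1' : Store.Agree r' s' ((s'.setReg (r' + 1) 1).setReg r' k) :=
      (Store.Agree.setReg _ (by omega) _).trans (Store.Agree.setReg _ (by omega) _)
    refine ⟨_, _, e, ?_, ⟨fun i hi => ?_, ?_⟩, ?_⟩
    · rw [ha1'.2 0 h0, ha 0 h0] at ht
      omega
    · rw [hv' i (by omega), ha1'.2 i hi, ha i hi]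
    · rw [← hv, loopDown, ha']
      congr 1
      simp only [Store.reg_setReg, if_true]
      exact hb0 (s := ⟨s.reg, s'.arr⟩) (s' := (s'.setReg (r' + 1) 1).setReg r' k)
        ⟨rfl, fun i hi => (ha1'.2 i (hi.trans_le hr')).trans (ha i (hi.trans_le hr'))⟩ k
    · simpa [Store.reg_setReg] using hv' r' (by omega))
  obtain ⟨t3, s3, e3, ht3, ha3, hv3⟩ := hloop (by omega) (min (n s) (s.reg 0)) s2
    ⟨ha2.2, by rw [ha2.1]⟩ hv2
  refine ⟨_, _, .seq e2 e3, ?_, hv3, ha3⟩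
  have : min (n s) (s.reg 0) * (qb.eval (s.reg 0) + 3) ≤
    s.reg 0 * (qb.eval (s.reg 0) + 3) := Nat.mul_le_mul_right _ (min_le_right _ _)
  simp only [Polynomial.eval_add, Polynomial.eval_mul, Polynomial.eval_X, Polynomial.eval_one,
    Polynomial.eval_ofNat]
  omega

end Act

/-! ### The arithmetic of the program

In the following functions `K` is a bound for the numbers of repetitions and `a` are the arrays:
`a 0` holds the input and `a 1` holds the permutation built so far. -/

/-- The product of `y` with the smaller of `x` and `K`. -/
def boundedMul (K x y : ℕ) : ℕ := ∑ _i ∈ Finset.range (min x K), y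

/-- The remainder of `x` modulo `y`, by at most `K` subtractions. -/
def boundedMod (K x y : ℕ) : ℕ := (fun z => if y - z = 0 then z - y else z)^[min x K] x

/-- The smaller of `x ^ p` and `K`. -/
def boundedPow (K x p : ℕ) : ℕ := (fun y => min (boundedMul K (min x K) y) K)^[min p K] 1

/-- The least common multiple of `x` and `y`, or `0` if it exceeds `K`. -/
def boundedLcm (K x y : ℕ) : ℕ := search (fun m => boundedMod K m x + boundedMod K m y) K

/-- The anti-lcm of `b` with respect to `x`, or `0` if there is none. -/
def boundedAlcm (K x b : ℕ) : ℕ :=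
  if b = 0 then 0 else search (fun c => Nat.dist (boundedLcm K x c) b) K

/-- The number of fixed points of the `m`-th iterate of the graph with `n` states whose successors
are listed in `A` from the position `q` on. -/
def arrayCount (K : ℕ) (A : ℕ → ℕ) (q n m : ℕ) : ℕ :=
  ∑ i ∈ Finset.range (min n K),
    if Nat.dist i ((fun c => A (q + c))^[min m K] i) = 0 then 1 else 0

/-- The position of the `j`-th monomial in the input. -/
def termPos (K : ℕ) (a : ℕ → ℕ → ℕ) (j : ℕ) : ℕ := (fun q => q + (a 0 (q + 1) + 2))^[min j K] 1

def inputPeval (K : ℕ) (a : ℕ → ℕ → ℕ) (m x : ℕ) : ℕ :=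
  ∑ j ∈ Finset.range (min (a 0 0) K),
    boundedMul K (arrayCount K (a 0) (termPos K a j + 2) (a 0 (termPos K a j + 1)) m)
      (boundedPow K x (a 0 (termPos K a j)))

def inputNonconst (K : ℕ) (a : ℕ → ℕ → ℕ) (m : ℕ) : ℕ :=
  ∑ j ∈ Finset.range (min (a 0 0) K), if a 0 (termPos K a j) = 0 then 0 else
    arrayCount K (a 0) (termPos K a j + 2) (a 0 (termPos K a j + 1)) m

def inputSize (K : ℕ) (a : ℕ → ℕ → ℕ) : ℕ :=
  (∑ j ∈ Finset.range (min (a 0 0) K), a 0 (termPos K a j + 1)) + a 0 (termPos K a (a 0 0))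

def targetCount (K : ℕ) (a : ℕ → ℕ → ℕ) (m : ℕ) : ℕ :=
  arrayCount K (a 0) (termPos K a (a 0 0) + 1) (a 0 (termPos K a (a 0 0))) m

/-- The value of the polynomial at the permutation built so far, by numbers of fixed points. -/
def currentPeval (K : ℕ) (a : ℕ → ℕ → ℕ) (m : ℕ) : ℕ :=
  inputPeval K a m (arrayCount K (a 1) 2 (a 1 1) m)

/-- The length of the next cycle, or `0` if there is none. -/
def nextLength (K : ℕ) (a : ℕ → ℕ → ℕ) : ℕ :=
  boundedAlcm K (search (fun b => 1 - inputNonconst K a b) K)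
    (search (fun b => currentPeval K a b + 1 - targetCount K a b) K)

/-- It is `0` if and only if the permutation built so far is a solution. -/
def defect (K : ℕ) (a : ℕ → ℕ → ℕ) : ℕ :=
  ∑ m ∈ Finset.range (min K K), Nat.dist (currentPeval K a m) (targetCount K a m)

/-- Write the successors of a new cycle of length `c` on the states `n, …, n + c - 1`. -/
def writeCycle (K c n : ℕ) (a : ℕ → ℕ → ℕ) : ℕ → ℕ → ℕ :=
  loopDown (fun i a => Function.update a 1 (Function.update (a 1) (2 + n + i)
    (if Nat.dist (i + 1) c = 0 then n else n + (i + 1)))) (min c K) a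

def appendCycle (K c n : ℕ) (a : ℕ → ℕ → ℕ) : ℕ → ℕ → ℕ :=
  Function.update (writeCycle K c n a) 1 (Function.update (writeCycle K c n a 1) 1 (n + c))

def addNext (K : ℕ) (a : ℕ → ℕ → ℕ) : ℕ → ℕ → ℕ :=
  if a 1 1 + nextLength K a + 1 - K = 0 then appendCycle K (nextLength K a) (a 1 1) a else a

def finish (K : ℕ) (a : ℕ → ℕ → ℕ) : ℕ → ℕ → ℕ :=
  Function.update a 1 (Function.update (a 1) 0 (if defect K a = 0 then 1 else 0))

/-! ### Exactness of the truncated arithmetic -/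

theorem boundedMul_eq (K x y : ℕ) : boundedMul K x y = min x K * y := by
  simp [boundedMul]

theorem boundedMod_eq {K x y : ℕ} (hx : x ≤ K) (hy : 0 < y) : boundedMod K x y = x % y := by
  rw [boundedMod, min_eq_left hx]
  suffices h : ∀ k z, z ≤ k → (fun z => if y - z = 0 then z - y else z)^[k] z = z % y from
    h x x le_rfl
  intro k
  induction k with
  | zero =>
    intro z hz
    rw [Nat.le_zero.1 hz]
    simp
  | succ k ih =>
    intro z hz
    by_cases h : y ≤ z
    · rw [Function.iterate_succ_apply, if_pos (Nat.sub_eq_zero_of_le h), ih _ (by omega),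
        ← Nat.mod_eq_sub_mod h]
    · rw [Function.iterate_fixed, Nat.mod_eq_of_lt (not_le.1 h)]
      rw [if_neg (by omega)]

/-- Truncating the factors at `K` does not change the truncated product. Capping the exponent is
necessary, as exponents do not count in the size of `P`, and harmless: powers of `0` and `1` are
constant for positive exponents, and `K < x ^ K` for `x ≥ 2`. -/
theorem boundedPow_eq {K : ℕ} (hK : 0 < K) (x p : ℕ) : boundedPow K x p = min (x ^ p) K := by
  have h (k : ℕ) : (fun y => min (boundedMul K (min x K) y) K)^[k] 1 = min (x ^ k) K := by
    induction k with
    | zero => simp; omega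
    | succ k ih =>
      rw [Function.iterate_succ_apply', ih, boundedMul_eq, min_assoc, min_self, pow_succ']
      rcases le_total x K with h1 | h1
      · rcases le_total (x ^ k) K with h2 | h2
        · rw [min_eq_left h1, min_eq_left h2]
        · rw [min_eq_left h1, min_eq_right h2]
          rcases Nat.eq_zero_or_pos x with h0 | h0
          · simp [h0]
          · rw [min_eq_right (Nat.le_mul_of_pos_left K h0),
              min_eq_right (h2.trans (Nat.le_mul_of_pos_left _ h0))]
      · have h0 : 0 < x ^ k := Nat.pow_pos (hK.trans_le h1)
        have h3 : 0 < min (x ^ k) K := lt_min h0 hK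
        rw [min_eq_right h1, min_eq_right (Nat.le_mul_of_pos_right K h3),
          min_eq_right (h1.trans (Nat.le_mul_of_pos_right _ h0))]
  rw [boundedPow, h]
  rcases le_total p K with hp | hp
  · rw [min_eq_left hp]
  · rw [min_eq_right hp]
    rcases x with _ | _ | x
    · rw [zero_pow hK.ne', zero_pow (by omega)]
    · simp
    · have h1 : K < (x + 2) ^ K := Nat.lt_pow_self (by omega)
      rw [min_eq_right h1.le, min_eq_right (h1.le.trans (Nat.pow_le_pow_right (by omega) hp))]

theorem boundedLcm_eq_iff {K x y b : ℕ} (hx : 0 < x) (hy : 0 < y) (hb : 0 < b) (hbK : b ≤ K) :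
    boundedLcm K x y = b ↔ Nat.lcm x y = b := by
  have hl : 0 < Nat.lcm x y := Nat.lcm_pos hx hy
  have hzero {m} (hm : m ≤ K) : boundedMod K m x + boundedMod K m y = 0 ↔ Nat.lcm x y ∣ m := by
    rw [boundedMod_eq hm hx, boundedMod_eq hm hy, Nat.add_eq_zero_iff, ← Nat.dvd_iff_mod_eq_zero,
      ← Nat.dvd_iff_mod_eq_zero, Nat.lcm_dvd_iff]
  have hle (h : Nat.lcm x y ≤ K) : boundedLcm K x y = Nat.lcm x y := by
    refine search_eq hl h ((hzero h).2 dvd_rfl) fun c hc hc' h0 => ?_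
    have := Nat.le_of_dvd hc ((hzero (by omega)).1 h0)
    omega
  constructor
  · intro h
    rcases search_spec (fun m => boundedMod K m x + boundedMod K m y) K with ⟨h1, -⟩ | ⟨-, -, h1, -⟩
    · rw [boundedLcm, h1] at h
      omega
    · rw [← boundedLcm, h] at h1
      rw [← hle ((Nat.le_of_dvd hb ((hzero hbK).1 h1)).trans hbK), h]
  · intro h
    rw [hle (h ▸ hbK), h]

theorem dist_eq_zero_iff {x y : ℕ} : Nat.dist x y = 0 ↔ x = y :=
  ⟨Nat.eq_of_dist_eq_zero, Nat.dist_eq_zero⟩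

/-- The search up to `K` reaches the anti-lcm because `b` itself is a solution of `lcm x c = b`. -/
theorem boundedAlcm_eq {K x b : ℕ} (hx : 0 < x) (hb : 0 < b) (hbK : b ≤ K) (h : x ∣ b) :
    boundedAlcm K x b = alcm x b := by
  rw [boundedAlcm, if_neg hb.ne']
  have hspec := alcm_spec (Nat.lcm_eq_right h)
  have ha := alcm_pos hb h
  refine search_eq ha ?_ ?_ fun c hc hc' h0 => ?_
  · exact (Nat.sInf_le (s := {c | Nat.lcm x c = b}) (Nat.lcm_eq_right h)).trans hbK
  · rw [dist_eq_zero_iff, boundedLcm_eq_iff hx ha hb hbK, hspec]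
  · rw [dist_eq_zero_iff, boundedLcm_eq_iff hx hc hb hbK] at h0
    exact Nat.notMem_of_lt_sInf hc' h0

/-! ### Words in arrays -/

/-- The word `l` stands in `A` from the position `q` on. -/
def WordAt (A : ℕ → ℕ) (q : ℕ) (l : List ℕ) : Prop := ∀ j < l.length, A (q + j) = l.getD j 0

theorem wordAt_cons {A : ℕ → ℕ} {q x : ℕ} {l : List ℕ} :
    WordAt A q (x :: l) ↔ A q = x ∧ WordAt A (q + 1) l := by
  constructor
  · intro h
    refine ⟨h 0 (by simp), fun j hj => ?_⟩
    have := h (j + 1) (by simpa using hj)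
    rwa [List.getD_cons_succ, show q + (j + 1) = q + 1 + j by ring] at this
  · rintro ⟨h0, h⟩ (_ | j) hj
    · exact h0
    · rw [List.getD_cons_succ, ← h j (by simpa using hj), show q + (j + 1) = q + 1 + j by ring]

theorem wordAt_append {A : ℕ → ℕ} {q : ℕ} {l l' : List ℕ} :
    WordAt A q (l ++ l') ↔ WordAt A q l ∧ WordAt A (q + l.length) l' := by
  induction l generalizing q with
  | nil => simp [WordAt]
  | cons x l ih =>
    rw [List.cons_append, wordAt_cons, wordAt_cons, ih, and_assoc, List.length_cons,
      show q + (l.length + 1) = q + 1 + l.length by ring]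

theorem wordAt_encode {A : ℕ → ℕ} {q : ℕ} {G : PermGraph} :
    WordAt A q G.encode ↔ A q = G.n ∧ ∀ i : Fin G.n, A (q + 1 + i) = G.next i := by
  rw [PermGraph.encode, wordAt_cons]
  refine and_congr_right fun _ => ⟨fun h i => ?_, fun h j hj => ?_⟩
  · rw [h i (by simp)]
    simp
  · rw [List.length_ofFn] at hj
    rw [h ⟨j, hj⟩]
    simp [hj]

theorem length_encode (G : PermGraph) : G.encode.length = G.n + 1 := by
  simp [PermGraph.encode]

theorem arrayCount_eq {K : ℕ} {A : ℕ → ℕ} {q m : ℕ} {G : PermGraph} (h : WordAt A q G.encode)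
    (hG : G.n ≤ K) (hm : m ≤ K) : arrayCount K A (q + 1) (A q) m = G.toFDDS.fixCount m := by
  obtain ⟨h0, h1⟩ := wordAt_encode.1 h
  have hit (i : Fin G.n) : (fun c => A (q + 1 + c))^[m] i = (G.next^[m] i : Fin G.n) := by
    clear hm
    induction m with
    | zero => rfl
    | succ m ih => rw [Function.iterate_succ_apply', ih, h1, Function.iterate_succ_apply']
  rw [arrayCount, h0, min_eq_left hG, min_eq_left hm, Finset.sum_range]
  simp only [hit, dist_eq_zero_iff]
  change _ = Nat.card {s : Fin G.n // G.next^[m] s = s}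
  rw [Nat.card_eq_fintype_card, Fintype.card_subtype, Finset.card_filter]
  refine Finset.sum_congr rfl fun i _ => ?_
  simp only [← Fin.ext_iff, eq_comm]

/-- The word of a list of monomials. -/
abbrev encodeTerms (L : List (ℕ × PermGraph)) : List ℕ := L.flatMap fun m => m.1 :: m.2.encode

/-- The position after the monomial at the position `q`. -/
theorem iterate_terms {A : ℕ → ℕ} {q : ℕ} {L : List (ℕ × PermGraph)}
    (h : WordAt A q (encodeTerms L)) :
    (fun q => q + (A (q + 1) + 2))^[L.length] q = q + (encodeTerms L).length := by
  induction L generalizing q with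
  | nil => rfl
  | cons m L ih =>
    rw [encodeTerms, List.flatMap_cons, List.cons_append, wordAt_cons, wordAt_append] at h
    obtain ⟨h0, h1, h2⟩ := h
    rw [List.length_cons, Function.iterate_succ_apply, (wordAt_encode.1 h1).1]
    rw [length_encode, show q + 1 + (m.2.n + 1) = q + (m.2.n + 2) by ring] at h2
    rw [ih h2, encodeTerms, encodeTerms, List.flatMap_cons, List.cons_append, List.length_cons,
      List.length_append, length_encode]
    ring

theorem sum_terms {A : ℕ → ℕ} {q : ℕ} {L : List (ℕ × PermGraph)} {F : ℕ → ℕ}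
    {G : ℕ × PermGraph → ℕ} (h : WordAt A q (encodeTerms L))
    (hFG : ∀ m ∈ L, ∀ q, A q = m.1 → WordAt A (q + 1) m.2.encode → F q = G m) :
    ∑ j ∈ Finset.range L.length, F ((fun q => q + (A (q + 1) + 2))^[j] q) = (L.map G).sum := by
  induction L generalizing q with
  | nil => rfl
  | cons m L ih =>
    rw [encodeTerms, List.flatMap_cons, List.cons_append, wordAt_cons, wordAt_append] at h
    obtain ⟨h0, h1, h2⟩ := h
    rw [length_encode, show q + 1 + (m.2.n + 1) = q + (m.2.n + 2) by ring] at h2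
    rw [List.length_cons, Finset.sum_range_succ', List.map_cons, List.sum_cons,
      ← ih h2 fun m hm => hFG m (List.mem_cons_of_mem _ hm), ← hFG m List.mem_cons_self q h0 h1,
      add_comm]
    simp only [Function.iterate_succ_apply, (wordAt_encode.1 h1).1, Function.iterate_zero, id]

/-! ### The input -/

/-- The array `a 0` holds the equation. -/
def IsInput (P : PermPoly) (B : PermGraph) (a : ℕ → ℕ → ℕ) : Prop :=
  WordAt (a 0) 0 (encodeEquation P B)

section Input

variable {P : PermPoly} {B : PermGraph} {a : ℕ → ℕ → ℕ} {K m : ℕ}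

theorem IsInput.split (h : IsInput P B a) : a 0 0 = P.terms.length ∧
    WordAt (a 0) 1 (encodeTerms P.terms) ∧
    WordAt (a 0) (1 + (encodeTerms P.terms).length) B.encode := by
  rw [IsInput, encodeEquation, List.cons_append, wordAt_cons, wordAt_append] at h
  simpa using h

theorem IsInput.sum_eq (h : IsInput P B a) (hK : P.terms.length ≤ K) {F : ℕ → ℕ}
    {G : ℕ × PermGraph → ℕ}
    (hFG : ∀ m ∈ P.terms, ∀ q, a 0 q = m.1 → WordAt (a 0) (q + 1) m.2.encode → F q = G m) :
    ∑ j ∈ Finset.range (min (a 0 0) K), F (termPos K a j) = (P.terms.map G).sum := by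
  obtain ⟨h0, h1, -⟩ := h.split
  rw [h0, min_eq_left hK, ← sum_terms h1 hFG]
  refine Finset.sum_congr rfl fun j hj => ?_
  rw [termPos, min_eq_left ((Finset.mem_range.1 hj).le.trans hK)]

theorem IsInput.wordAt_target (h : IsInput P B a) (hK : P.terms.length ≤ K) :
    WordAt (a 0) (termPos K a (a 0 0)) B.encode := by
  obtain ⟨h0, h1, h2⟩ := h.split
  rwa [termPos, h0, min_eq_left hK, iterate_terms h1]

theorem IsInput.inputSize_eq (h : IsInput P B a) (hK : P.terms.length ≤ K) :
    inputSize K a = P.size + B.n := by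
  rw [inputSize, (wordAt_encode.1 (h.wordAt_target hK)).1, PermPoly.size,
    h.sum_eq hK (F := fun q => a 0 (q + 1)) (G := fun m => m.2.n)]
  exact fun m _ q _ hq => (wordAt_encode.1 hq).1

theorem PermPoly.length_terms_le (P : PermPoly) : P.terms.length ≤ P.size := by
  have h := P.ne_zero
  rw [PermPoly.size]
  generalize P.terms = L at h ⊢
  induction L with
  | nil => simp
  | cons m L ih =>
    have h1 := ih fun m hm => h m (List.mem_cons_of_mem _ hm)
    have h2 := h m List.mem_cons_self
    rw [List.length_cons, List.map_cons, List.sum_cons]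
    omega

theorem PermPoly.le_size (P : PermPoly) {t : ℕ × PermGraph} (ht : t ∈ P.terms) : t.2.n ≤ P.size :=
  List.single_le_sum (by simp) _ (List.mem_map.2 ⟨t, ht, rfl⟩)

theorem IsInput.targetCount_eq (h : IsInput P B a) (hK : P.size + B.n < K) (hm : m ≤ K) :
    targetCount K a m = B.toFDDS.fixCount m :=
  arrayCount_eq (h.wordAt_target (by have := P.length_terms_le; omega)) (by omega) hm

theorem IsInput.inputNonconst_eq (h : IsInput P B a) (hK : P.size + B.n < K) (hm : m ≤ K) :
    inputNonconst K a m = P.nonconstCount m := by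
  refine h.sum_eq (F := fun q => if a 0 q = 0 then 0 else arrayCount K (a 0) (q + 2)
    (a 0 (q + 1)) m) (by have := P.length_terms_le; omega) fun t ht q h0 hq => ?_
  have := P.le_size ht
  rw [h0, ← arrayCount_eq hq (by omega) hm]

theorem min_sum_congr {α : Type} (L : List α) {f g : α → ℕ} {K : ℕ}
    (h : ∀ x ∈ L, min (f x) K = min (g x) K) :
    min (L.map f).sum K = min (L.map g).sum K := by
  induction L with
  | nil => rfl
  | cons x L ih =>
    have h1 := ih fun y hy => h y (List.mem_cons_of_mem _ hy)
    have h2 := h x List.mem_cons_self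
    simp only [List.map_cons, List.sum_cons]
    omega

/-- Powers are truncated, so the computed value is reliable only up to `K`; this is enough for
comparisons with numbers below `K`. -/
theorem IsInput.min_inputPeval (h : IsInput P B a) (hK : P.size + B.n < K) (hm : m ≤ K) (x : ℕ) :
    min (inputPeval K a m x) K = min (P.peval m x) K := by
  rw [inputPeval, h.sum_eq (F := fun q => boundedMul K (arrayCount K (a 0) (q + 2)
    (a 0 (q + 1)) m) (boundedPow K x (a 0 q)))
    (G := fun t => t.2.toFDDS.fixCount m * min (x ^ t.1) K)
    (by have := P.length_terms_le; omega) fun t ht q h0 hq => ?_, PermPoly.peval]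
  · refine min_sum_congr _ fun t _ => ?_
    rcases Nat.eq_zero_or_pos (t.2.toFDDS.fixCount m) with h0 | h0
    · simp [h0]
    · rcases le_total (x ^ t.1) K with h1 | h1
      · rw [min_eq_left h1]
      · rw [min_eq_right h1, min_eq_right (Nat.le_mul_of_pos_left K h0),
          min_eq_right (h1.trans (Nat.le_mul_of_pos_left _ h0))]
  · have := P.le_size ht
    have hc : t.2.toFDDS.fixCount m ≤ K := by
      refine le_trans ?_ (show t.2.toFDDS.size ≤ K by rw [t.2.size_toFDDS]; omega)
      exact Nat.card_le_card_of_injective _ Subtype.val_injective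
    have hw := arrayCount_eq hq (by omega) hm
    rw [show q + 1 + 1 = q + 2 from rfl] at hw
    rw [hw, h0, boundedPow_eq (by omega), boundedMul_eq, min_eq_left hc]

end Input

/-! ### The loop of the program -/

/-- The permutation `X` with a further cycle of length `c`. -/
def PermGraph.appendCycle (X : PermGraph) (c : ℕ) : PermGraph :=
  ⟨X.n + c, finSumFinEquiv.permCongr (Equiv.sumCongr X.next (finRotate c))⟩

theorem PermGraph.fixCount_appendCycle (X : PermGraph) (c n : ℕ) :
    (X.appendCycle c).toFDDS.fixCount n = X.toFDDS.fixCount n + if c ∣ n then c else 0 := by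
  rw [← FDDS.fixCount_cycle, ← FDDS.fixCount_add]
  have h (s : Fin X.n ⊕ Fin c) : finSumFinEquiv (Sum.map X.next (finRotate c) s) =
      finSumFinEquiv.permCongr (Equiv.sumCongr X.next (finRotate c)) (finSumFinEquiv s) := by
    rw [Equiv.permCongr_apply, Equiv.symm_apply_apply]
    rfl
  exact (FDDS.Iso.fixCount_eq ⟨finSumFinEquiv, h⟩ n).symm

/-- The successor of state `i` is stored at position `2 + i`, so position `j` inside the new cycle
gets `j - 1`, except that the last one returns to `n`. -/
theorem writeCycle_eq {K c n : ℕ} (hc : c ≤ K) (a : ℕ → ℕ → ℕ) :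
    writeCycle K c n a = Function.update a 1 fun j =>
      if 2 + n ≤ j ∧ j < 2 + n + c then if j + 1 = 2 + n + c then n else j - 1 else a 1 j := by
  rw [writeCycle, min_eq_left hc]
  suffices h : ∀ k (a : ℕ → ℕ → ℕ), loopDown (fun i a => Function.update a 1 (Function.update (a 1) (2 + n + i)
      (if Nat.dist (i + 1) c = 0 then n else n + (i + 1)))) k a = Function.update a 1 fun j =>
        if 2 + n ≤ j ∧ j < 2 + n + k then if j + 1 = 2 + n + c then n else j - 1 else a 1 j from
    h c a
  intro k
  induction k with
  | zero =>
    intro a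
    rw [loopDown]
    refine (Function.update_eq_self_iff.2 ?_).symm
    funext j
    rw [if_neg (by omega)]
  | succ k ih =>
    intro a
    rw [loopDown, ih, Function.update_idem, Function.update_self]
    congr 1
    funext j
    simp only [Function.update_apply, dist_eq_zero_iff]
    grind

theorem wordAt_appendCycle {K c : ℕ} {a : ℕ → ℕ → ℕ} {X : PermGraph}
    (h : WordAt (a 1) 1 X.encode) (hc : c ≤ K) :
    WordAt (appendCycle K c X.n a 1) 1 (X.appendCycle c).encode := by
  obtain ⟨-, h1⟩ := wordAt_encode.1 h
  rw [wordAt_encode, appendCycle, writeCycle_eq hc]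
  simp only [Function.update_self]
  suffices h2 : ∀ i : Fin (X.n + c), (if 2 + X.n ≤ 1 + 1 + i ∧ 1 + 1 + i < 2 + X.n + c then
      if 1 + 1 + i + 1 = 2 + X.n + c then X.n else 1 + 1 + i - 1 else a 1 (1 + 1 + i)) =
      (finSumFinEquiv.permCongr (Equiv.sumCongr X.next (finRotate c)) i : ℕ) by
    refine ⟨rfl, fun i => ?_⟩
    rw [Function.update_of_ne (by omega)]
    exact h2 i
  intro i
  obtain ⟨s, rfl⟩ := finSumFinEquiv.surjective i
  rw [Equiv.permCongr_apply, Equiv.symm_apply_apply]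
  rcases s with s | s
  · have := s.2
    rw [Equiv.sumCongr_apply, Sum.map_inl, finSumFinEquiv_apply_left, finSumFinEquiv_apply_left,
      Fin.val_castAdd, Fin.val_castAdd, if_neg (by omega), ← h1]
  · have := s.2
    rw [Equiv.sumCongr_apply, Sum.map_inr, finSumFinEquiv_apply_right, finSumFinEquiv_apply_right,
      Fin.val_natAdd, Fin.val_natAdd, val_finRotate, if_pos (by omega)]
    by_cases hs : s.1 + 1 = c
    · rw [hs, Nat.mod_self, if_pos (by omega), add_zero]
    · rw [Nat.mod_eq_of_lt (by omega), if_neg (by omega)]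
      omega

/-- `a 0` holds the equation and `a 1` holds the permutation `X`, from the position `1` on. -/
structure IsState (P : PermPoly) (B : PermGraph) (K : ℕ) (a : ℕ → ℕ → ℕ) (X : PermGraph) :
    Prop where
  input : IsInput P B a
  word : WordAt (a 1) 1 X.encode
  lt : X.n < K

section State

variable {P : PermPoly} {B X : PermGraph} {a : ℕ → ℕ → ℕ} {K m : ℕ} {R : List ℕ}

theorem IsState.min_currentPeval (h : IsState P B K a X) (hK : P.size + B.n < K) (hm : m ≤ K) :
    min (currentPeval K a m) K = min (P.peval m (X.toFDDS.fixCount m)) K := by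
  rw [currentPeval, h.input.min_inputPeval hK hm, ← arrayCount_eq h.word h.lt.le hm]

theorem PermGraph.fixCount_le (B : PermGraph) (m : ℕ) : B.toFDDS.fixCount m ≤ B.n := by
  rw [← B.size_toFDDS]
  exact Nat.card_le_card_of_injective _ Subtype.val_injective

/-- The size test keeps the array a valid graph with fewer than `K` states even when no solution
exists and the next length has no meaning. -/
theorem IsState.isState_addNext (h : IsState P B K a X) :
    if X.n + nextLength K a < K then IsState P B K (addNext K a) (X.appendCycle (nextLength K a))
    else IsState P B K (addNext K a) X := by
  have hn := (wordAt_encode.1 h.word).1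
  split_ifs with hlt
  · rw [addNext, hn, if_pos (by omega)]
    refine ⟨?_, wordAt_appendCycle h.word (by omega), hlt⟩
    rw [IsInput, appendCycle, writeCycle_eq (by omega), Function.update_of_ne (by omega),
      Function.update_of_ne (by omega)]
    exact h.input
  · rw [addNext, hn, if_neg (by omega)]
    exact h

theorem IsState.nextLength_mem (h : IsState P B K a X) (hK : P.size + B.n < K)
    (hP : P.PseudoInjective) (hR : P.Completes B.toFDDS X.toFDDS R) :
    (R = [] ∧ nextLength K a = 0) ∨ nextLength K a ∈ R := by
  -- The count of `B` is below `K`, so truncation of the other side does not affect the comparison.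
  have hiff (b : ℕ) (hb : b ≤ K) : currentPeval K a b + 1 - targetCount K a b = 0 ↔
      P.peval b (X.toFDDS.fixCount b) < B.toFDDS.fixCount b := by
    have h1 := h.min_currentPeval hK hb
    have h2 := B.fixCount_le b
    rw [h.input.targetCount_eq hK hb]
    omega
  rw [nextLength]
  by_cases hnil : R = []
  · subst hnil
    refine Or.inl ⟨rfl, ?_⟩
    rw [search_eq_zero (f := fun b => currentPeval K a b + 1 - targetCount K a b)
      fun b _ hb h0 => hR.not_lt b ((hiff b hb).1 h0), boundedAlcm, if_pos rfl]
  · obtain ⟨l, D, hl, hgl, hlB, hmem, hlt, hmin, -⟩ := hR.exists_least hP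
      B.toFDDS_isPermutation X.toFDDS_isPermutation hnil
    rw [B.size_toFDDS] at hlB
    have hg := Nat.le_of_dvd hl hgl
    have hnc {b : ℕ} (hb : b ≤ K) : 1 - inputNonconst K a b = 0 ↔ P.seed ∣ b := by
      rw [h.input.inputNonconst_eq hK hb, ← hP.nonconstCount_pos]
      omega
    right
    rw [search_eq (f := fun b => currentPeval K a b + 1 - targetCount K a b) (b := l) hl
      (by omega) ((hiff l (by omega)).2 hlt)
      fun c hc hcl h0 => hmin c hc hcl ((hiff c (by omega)).1 h0),
      search_eq (f := fun b => 1 - inputNonconst K a b) (b := P.seed) hP.seed_pos (by omega)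
      ((hnc (by omega)).2 dvd_rfl) fun c hc hcg h0 => ?_,
      boundedAlcm_eq hP.seed_pos hl (by omega) hgl]
    · exact hmem
    · have := Nat.le_of_dvd hc ((hnc (by omega)).1 h0)
      omega

theorem IsState.exists_loop (h : IsState P B K a X) (k : ℕ) :
    ∃ X', IsState P B K (loopDown (fun _ a => addNext K a) k a) X' := by
  induction k generalizing a X with
  | zero => exact ⟨X, h⟩
  | succ k ih =>
    have := h.isState_addNext
    split_ifs at this
    · exact ih this
    · exact ih this

theorem IsState.exists_loop_completes (h : IsState P B K a X) (hK : P.size + B.n < K)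
    (hP : P.PseudoInjective) (hR : P.Completes B.toFDDS X.toFDDS R) {k : ℕ} (hk : R.length ≤ k) :
    ∃ X', IsState P B K (loopDown (fun _ a => addNext K a) k a) X' ∧
      P.Completes B.toFDDS X'.toFDDS [] ∧
      ∀ n, X'.toFDDS.fixCount n = X.toFDDS.fixCount n + FDDS.listCount R n := by
  induction k generalizing a X R with
  | zero =>
    obtain rfl := List.length_eq_zero_iff.1 (Nat.le_zero.1 hk)
    exact ⟨X, h, hR, fun n => rfl⟩
  | succ k ih =>
    have hle := hR.listCount_zero_le hP
    rw [X.size_toFDDS, B.size_toFDDS] at hle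
    have hadd := h.isState_addNext
    have happ (n : ℕ) := X.fixCount_appendCycle (nextLength K a) n
    rcases h.nextLength_mem hK hP hR with ⟨rfl, h0⟩ | hmem
    -- Once the solution is complete, the remaining rounds append cycles of length `0`, which change
    -- nothing.
    · rw [if_pos (by omega)] at hadd
      have hfix (n : ℕ) : (X.appendCycle (nextLength K a)).toFDDS.fixCount n =
          X.toFDDS.fixCount n := by
        rw [happ, h0]
        split_ifs <;> rfl
      obtain ⟨X', h1, h2, h3⟩ := ih hadd (R := []) ⟨by simp, fun n => by rw [hfix, hR.count]⟩
        (Nat.zero_le _)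
      exact ⟨X', h1, h2, fun n => by rw [h3, hfix]⟩
    · have := FDDS.le_listCount_zero hmem
      rw [if_pos (by omega)] at hadd
      obtain ⟨X', h1, h2, h3⟩ := ih hadd (hR.erase hmem happ)
        (by rw [List.length_erase_of_mem hmem]; omega)
      refine ⟨X', h1, h2, fun n => ?_⟩
      rw [h3, happ, FDDS.listCount_perm (List.perm_cons_erase hmem), FDDS.listCount_cons, add_assoc]

/-- The tested `m < K` include all `m ≤ B.n`, and these counts determine the permutation. -/
theorem IsState.defect_eq_zero_iff (h : IsState P B K a X) (hK : P.size + B.n < K) :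
    defect K a = 0 ↔ FDDS.Iso (P.eval X.toFDDS) B.toFDDS := by
  have hiff (m : ℕ) (hm : m < K) : Nat.dist (currentPeval K a m) (targetCount K a m) = 0 ↔
      (P.eval X.toFDDS).fixCount m = B.toFDDS.fixCount m := by
    have h1 := h.min_currentPeval hK hm.le
    have h2 := B.fixCount_le m
    rw [dist_eq_zero_iff, h.input.targetCount_eq hK hm.le, P.fixCount_eval]
    omega
  rw [defect, min_self, Finset.sum_eq_zero_iff]
  constructor
  · intro h0
    refine (FDDS.iso_of_fixCount_eq B.toFDDS_isPermutation
      (P.eval_isPermutation X.toFDDS_isPermutation) fun n hn => ?_).symm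
    rw [B.size_toFDDS] at hn
    exact ((hiff n (by omega)).1 (h0 n (Finset.mem_range.2 (by omega)))).symm
  · exact fun hiso m hm => (hiff m (Finset.mem_range.1 hm)).2 (hiso.fixCount_eq m)

end State

/-- The result of the loop is the result of the algorithm, and it is correct. -/
theorem exists_result {P : PermPoly} {B : PermGraph} (hP : P.PseudoInjective) {K : ℕ}
    (hK : P.size + B.n < K) {a : ℕ → ℕ → ℕ} (ha : IsInput P B a) (ha1 : a 1 1 = 0) :
    ∃ r : Option PermGraph,
      WordAt (finish K (loopDown (fun _ a => addNext K a) K a) 1) 0 (encodeResult r) ∧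
      PolyCycle P B r ∧
      (∀ X : PermGraph, r = some X → FDDS.Iso (P.eval X.toFDDS) B.toFDDS) ∧
      (r = none → ∀ X : FDDS, X.IsPermutation → ¬ FDDS.Iso (P.eval X) B.toFDDS) := by
  have h0 : IsState P B K a ⟨0, Equiv.refl _⟩ :=
    ⟨ha, wordAt_encode.2 ⟨ha1, fun i => i.elim0⟩, by dsimp only; omega⟩
  have hzero (n : ℕ) : (PermGraph.toFDDS ⟨0, Equiv.refl _⟩).fixCount n = 0 := by
    have := PermGraph.fixCount_le ⟨0, Equiv.refl _⟩ n
    exact Nat.le_zero.1 this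
  by_cases hsol : ∃ X : FDDS, X.IsPermutation ∧ FDDS.Iso (P.eval X) B.toFDDS
  · obtain ⟨X, hX, hiso⟩ := hsol
    obtain ⟨R, hR⟩ := PermPoly.exists_completes hP hX hiso
    have hR' : P.Completes B.toFDDS (PermGraph.toFDDS ⟨0, Equiv.refl _⟩) R :=
      ⟨hR.normal, fun n => by rw [hzero, ← hR.count, FDDS.fixCount_zero]⟩
    -- `K` rounds suffice: every missing cycle has a state, and together they have at most `B.n`.
    have hlen : R.length ≤ K := by
      have h1 := FDDS.length_le_listCount R fun b hb => (hR.normal b hb).1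
      have h2 := hR.listCount_zero_le hP
      rw [B.size_toFDDS] at h2
      omega
    obtain ⟨Y, h1, h2, h3⟩ := h0.exists_loop_completes hK hP hR' hlen
    have hY : FDDS.Iso (P.eval Y.toFDDS) B.toFDDS := by
      refine FDDS.iso_of_fixCount_eq (P.eval_isPermutation Y.toFDDS_isPermutation)
        B.toFDDS_isPermutation fun n _ => ?_
      rw [P.fixCount_eval, ← h2.count]
      rfl
    refine ⟨some Y, ?_, ?_, fun X hX => Option.some.inj hX ▸ hY, by simp⟩
    · rw [encodeResult, wordAt_cons, finish, (h1.defect_eq_zero_iff hK).2 hY]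
      refine ⟨by simp, fun j hj => ?_⟩
      rw [Function.update_self, Function.update_of_ne (by omega)]
      exact h1.word j hj
    · refine hR.polyCycleFrom hP FDDS.zero_isPermutation fun n => ?_
      rw [h3, hzero, FDDS.fixCount_zero]
  · have hno (X : FDDS) (hX : X.IsPermutation) : ¬ FDDS.Iso (P.eval X) B.toFDDS :=
      fun h => hsol ⟨X, hX, h⟩
    obtain ⟨Y, h1⟩ := h0.exists_loop K
    refine ⟨none, ?_, PermPoly.polyCycleFrom_none hP hno FDDS.zero_isPermutation, by simp,
      fun _ => hno⟩
    -- Whatever graph `Y` the rounds have produced, it is not a solution, so the final check writes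
    -- `0`.
    rw [encodeResult, wordAt_cons, finish,
      if_neg fun h => hno _ Y.toFDDS_isPermutation ((h1.defect_eq_zero_iff hK).1 h)]
    exact ⟨by simp, fun j hj => by simp at hj⟩

/-! ### The program -/

namespace Cmp

variable {r : ℕ} {f g h i : Store → ℕ}

theorem boundedMul (hf : Cmp r f) (hg : Cmp r g) :
    Cmp r fun s => boundedMul (s.reg 0) (f s) (g s) :=
  sum (b := fun _ => g) hf fun _ hR _ _ => hg.mono hR

theorem boundedMod (hf : Cmp r f) (hg : Cmp r g) :
    Cmp r fun s => boundedMod (s.reg 0) (f s) (g s) :=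
  iterate (b := fun z s => if g s - z = 0 then z - g s else z) hf hf fun _ hR _ hw =>
    ((hg.mono hR).sub hw).ite (hw.sub (hg.mono hR)) hw

theorem boundedPow (hf : Cmp r f) (hg : Cmp r g) :
    Cmp r fun s => boundedPow (s.reg 0) (f s) (g s) :=
  iterate (b := fun y s => Min.min (_root_.boundedMul (s.reg 0) (Min.min (f s) (s.reg 0)) y)
    (s.reg 0)) hg (const hf.pos 1) fun _ hR _ hw =>
      (((hf.mono hR).min (reg hw.pos)).boundedMul hw).min (reg hw.pos)

theorem boundedLcm (hf : Cmp r f) (hg : Cmp r g) :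
    Cmp r fun s => boundedLcm (s.reg 0) (f s) (g s) :=
  search (b := fun m s => _root_.boundedMod (s.reg 0) m (f s) + _root_.boundedMod (s.reg 0) m (g s))
    hf.pos fun _ hR _ hv => (hv.boundedMod (hf.mono hR)).add (hv.boundedMod (hg.mono hR))

theorem boundedAlcm (hf : Cmp r f) (hg : Cmp r g) :
    Cmp r fun s => boundedAlcm (s.reg 0) (f s) (g s) :=
  hg.ite (const hf.pos 0) <|
    search (b := fun c s => Nat.dist (_root_.boundedLcm (s.reg 0) (f s) c) (g s)) hf.pos
      fun _ hR _ hv => ((hf.mono hR).boundedLcm hv).dist (hg.mono hR)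

theorem arrayCount (t : ℕ) (hf : Cmp r f) (hg : Cmp r g) (hh : Cmp r h) :
    Cmp r fun s => arrayCount (s.reg 0) (s.arr t) (f s) (g s) (h s) :=
  sum (b := fun i s => if Nat.dist i ((fun c => s.arr t (f s + c))^[Min.min (h s) (s.reg 0)] i) = 0
    then 1 else 0) hg fun _ hR _ hv => (hv.dist
      (iterate (b := fun c s => s.arr t (f s + c)) (hh.mono hR) hv fun _ hR' _ hw =>
        load t ((hf.mono (hR.trans hR')).add hw))).ite (const hv.pos 1) (const hv.pos 0)

theorem termPos (hf : Cmp r f) : Cmp r fun s => termPos (s.reg 0) s.arr (f s) :=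
  iterate (b := fun q s => q + (s.arr 0 (q + 1) + 2)) hf (const hf.pos 1) fun _ _ _ hw =>
    hw.add ((load 0 (hw.add (const hw.pos 1))).add (const hw.pos 2))

theorem termCount (hf : Cmp r f) (hg : Cmp r g) : Cmp r fun s =>
    _root_.arrayCount (s.reg 0) (s.arr 0) (_root_.termPos (s.reg 0) s.arr (f s) + 2)
      (s.arr 0 (_root_.termPos (s.reg 0) s.arr (f s) + 1)) (g s) :=
  arrayCount 0 (hf.termPos.add (const hf.pos 2)) (load 0 (hf.termPos.add (const hf.pos 1))) hg

theorem inputPeval (hf : Cmp r f) (hg : Cmp r g) :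
    Cmp r fun s => inputPeval (s.reg 0) s.arr (f s) (g s) :=
  sum (load 0 (const hf.pos 0)) fun _ hR _ hv =>
    (hv.termCount (hf.mono hR)).boundedMul ((hg.mono hR).boundedPow (load 0 hv.termPos))

theorem inputNonconst (hf : Cmp r f) : Cmp r fun s => inputNonconst (s.reg 0) s.arr (f s) :=
  sum (load 0 (const hf.pos 0)) fun _ hR _ hv =>
    (load 0 hv.termPos).ite (const hv.pos 0) (hv.termCount (hf.mono hR))

theorem inputSize (hr : 0 < r) : Cmp r fun s => inputSize (s.reg 0) s.arr :=
  (sum (b := fun j s => s.arr 0 (_root_.termPos (s.reg 0) s.arr j + 1)) (load 0 (const hr 0))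
    fun _ _ _ hv => load 0 (hv.termPos.add (const hv.pos 1))).add
    (load 0 (load 0 (const hr 0)).termPos)

theorem targetCount (hf : Cmp r f) : Cmp r fun s => targetCount (s.reg 0) s.arr (f s) :=
  have h := (load 0 (const hf.pos 0)).termPos
  arrayCount 0 (h.add (const hf.pos 1)) (load 0 h) hf

theorem currentPeval (hf : Cmp r f) : Cmp r fun s => currentPeval (s.reg 0) s.arr (f s) :=
  hf.inputPeval (arrayCount 1 (const hf.pos 2) (load 1 (const hf.pos 1)) hf)

theorem nextLength (hr : 0 < r) : Cmp r fun s => nextLength (s.reg 0) s.arr :=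
  boundedAlcm
    (search (b := fun b s => 1 - _root_.inputNonconst (s.reg 0) s.arr b) hr
      fun _ _ _ hv => (const hv.pos 1).sub hv.inputNonconst)
    (search (b := fun b s => _root_.currentPeval (s.reg 0) s.arr b + 1 -
      _root_.targetCount (s.reg 0) s.arr b) hr
      fun _ _ _ hv => (hv.currentPeval.add (const hv.pos 1)).sub hv.targetCount)

theorem defect (hr : 0 < r) : Cmp r fun s => defect (s.reg 0) s.arr :=
  sum (b := fun m s => Nat.dist (_root_.currentPeval (s.reg 0) s.arr m)
    (_root_.targetCount (s.reg 0) s.arr m)) (reg hr)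
    fun _ _ _ hv => hv.currentPeval.dist hv.targetCount

end Cmp

namespace Act

variable {r : ℕ} {f g : Store → ℕ}

theorem writeCycle (hf : Cmp r f) (hg : Cmp r g) (hf' : ∀ s a, f ⟨s.reg, a⟩ = f s)
    (hg' : ∀ s a, g ⟨s.reg, a⟩ = g s) :
    Act r fun s => writeCycle (s.reg 0) (f s) (g s) s.arr := by
  have := loop (b := fun i s => Function.update s.arr 1 (Function.update (s.arr 1) (2 + g s + i)
    (if Nat.dist (i + 1) (f s) = 0 then g s else g s + (i + 1)))) hf fun R hR v hv _ =>
      have hv1 := hv.add (.const hv.pos 1)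
      store 1 (((Cmp.const hv.pos 2).add (hg.mono hR)).add hv)
        ((hv1.dist (hf.mono hR)).ite (hg.mono hR) ((hg.mono hR).add hv1))
  simpa only [hf', hg', _root_.writeCycle] using this

theorem appendCycle (hf : Cmp r f) (hg : Cmp r g) (hf' : ∀ s a, f ⟨s.reg, a⟩ = f s)
    (hg' : ∀ s a, g ⟨s.reg, a⟩ = g s) :
    Act r fun s => appendCycle (s.reg 0) (f s) (g s) s.arr := by
  have := seq (writeCycle hf hg hf' hg') (store 1 (.const hf.pos 1) (hg.add hf))
  simpa only [hf', hg', _root_.appendCycle] using this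

/-- The length and the number of states are both read from arrays that are about to change, so
`bind` saves them in registers first. -/
theorem addNext (hr : 0 < r) : Act r fun s => addNext (s.reg 0) s.arr :=
  bind (b := fun c s => if s.arr 1 1 + c + 1 - s.reg 0 = 0 then
      _root_.appendCycle (s.reg 0) c (s.arr 1 1) s.arr else s.arr) (.nextLength hr)
    fun _ _ v hv hv' => bind (b := fun n s => if n + v s + 1 - s.reg 0 = 0 then
        _root_.appendCycle (s.reg 0) (v s) n s.arr else s.arr) (.load 1 (.const hv.pos 1))
      fun _ hR _ hw hw' => ite
        (((hw.add (hv.mono hR)).add (.const hw.pos 1)).sub (.reg hw.pos))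
        (appendCycle (hv.mono hR) hw hv' hw') (skip hw.pos)

theorem finish (hr : 0 < r) : Act r fun s => finish (s.reg 0) s.arr :=
  store 1 (.const hr 0) ((Cmp.defect hr).ite (.const hr 1) (.const hr 0))

theorem addNext_loop_finish (hr : 0 < r) : Act r fun s =>
    _root_.finish (s.reg 0) (loopDown (fun _ a => _root_.addNext (s.reg 0) a) (s.reg 0) s.arr) := by
  have := seq (loop (b := fun _ s => _root_.addNext (s.reg 0) s.arr) (.reg hr)
    fun _ _ _ hv _ => addNext hv.pos) (finish hr)
  simpa only [min_self] using this

end Act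

theorem eval_mono_nat (q : Polynomial ℕ) {x y : ℕ} (h : x ≤ y) : q.eval x ≤ q.eval y := by
  rw [Polynomial.eval_eq_sum, Polynomial.eval_eq_sum]
  exact Finset.sum_le_sum fun i _ => Nat.mul_le_mul_left _ (Nat.pow_le_pow_left h i)

theorem mainTheorem5 :
    ∃ (prog : Prog) (q : Polynomial ℕ), ∀ (P : PermPoly) (B : PermGraph), P.PseudoInjective →
      ∃ (r : Option PermGraph) (t : ℕ) (s : Store),
        -- the program halts within polynomial time and outputs `r`
        Exec prog (Store.ofInput (encodeEquation P B)) t s ∧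
        t ≤ q.eval (P.size + B.n) ∧
        s.HasOutput (encodeResult r) ∧
        -- `r` is the result of the algorithm
        PolyCycle P B r ∧
        -- `r` is a solution, or it is `none` and there is no solution
        (∀ X : PermGraph, r = some X → FDDS.Iso (P.eval X.toFDDS) B.toFDDS) ∧
        (r = none → ∀ X : FDDS, X.IsPermutation → ¬ FDDS.Iso (P.eval X) B.toFDDS) := by
  obtain ⟨p1, q1, h1⟩ := (Cmp.inputSize one_pos).exec 1 le_rfl
  obtain ⟨p2, q2, h2⟩ := (Act.addNext_loop_finish one_pos).exec 1 le_rfl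
  -- Register `0` first holds the number of monomials, which suffices to walk through the input and
  -- compute its size; it is then set to that size plus one, the bound `K` of the main loop. The `3`
  -- counts the load, the constant and the addition.
  refine ⟨.seq (.load 0 0 0) (.seq p1 (.seq (.const 2 1) (.seq (.add 0 1 2) p2))),
    q1 + q2.comp (Polynomial.X + 1) + 3, fun P B hP => ?_⟩
  set s0 := Store.ofInput (encodeEquation P B) with hs0
  have hin : IsInput P B s0.arr := fun j _ => by
    rw [zero_add]
    rfl
  have hk : s0.arr 0 (s0.reg 0) = P.terms.length := hin.split.1
  obtain ⟨t1, s1, e1, ht1, ha1, hv1⟩ := h1 (s0.setReg 0 (s0.arr 0 (s0.reg 0)))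
  simp only [Store.reg_setReg, if_true, Store.arr_setReg, hk] at hv1 ht1
  rw [hin.inputSize_eq le_rfl] at hv1
  obtain ⟨t2, s2, e2, ht2, ha2, -⟩ := h2 ((s1.setReg 2 1).setReg 0 (s1.reg 1 + 1))
  simp only [Store.reg_setReg, if_true, Store.arr_setReg, ha1.1, hv1] at ha2 ht2
  obtain ⟨r, hr⟩ := exists_result hP (Nat.lt_succ_self (P.size + B.n)) hin rfl
  rw [Nat.succ_eq_add_one, ← ha2] at hr
  refine ⟨r, _, s2, .seq (.load 0 0 0 s0) (.seq e1 (.seq (.const 2 1 s1)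
    (.seq (.add 0 1 2 _) e2))), ?_, fun j hj => ?_, hr.2⟩
  · have := (ht1.trans (eval_mono_nat q1 P.length_terms_le)).trans
      (eval_mono_nat q1 (Nat.le_add_right P.size B.n))
    simp only [Polynomial.eval_add, Polynomial.eval_comp, Polynomial.eval_X, Polynomial.eval_one,
      Polynomial.eval_ofNat]
    omega
  · rw [← hr.1 j hj, zero_add]
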